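/- **Definitions.** Words are finite sequences of positive integers. *Weak $K$-Knuth equivalence* $\hat\equiv$ is the equivalence relation on words generated by the relations, for all words $\mathbf u,\mathbf v$ and all positive integers $a<b<c$: (1) $\mathbf u\,aa\,\mathbf v\sim \mathbf u\,a\,\mathbf v$; (2) $\mathbf u\,aba\,\mathbf v\sim\mathbf u\,bab\,\mathbf v$; (3) $\mathbf u\,bac\,\mathbf v\sim\mathbf u\,bca\,\mathbf v$; (4) $\mathbf u\,acb\,\mathbf v\sim\mathbf u\,cab\,\mathbf v$; (5) $ab\,\mathbf u\sim ba\,\mathbf u$. A word is *initial* if its set of letters is $[k]=\{1,\dots,k\}$ for some positive integer $k$. For an initial word $h$ let $[[h]]=\sum_{w\,\hat\equiv\,h}w$ (a formal infinite sum of words), and let $SKPR$ be the real vector space spanned by all the $[[h]]$ with $h$ initial. For initial words $h,h'$, where $h$ has largest letter $n$, put $$[[h]]\cdot[[h']]=\sum_{w\,\hat\equiv\,h,\ w'\,\hat\equiv\,h'} w \mathbin{\sqcup\!\sqcup} w'[n],$$ extended bilinearly, where $w'[n]$ is $w'$ with every letter increased by $n$ and $\mathbin{\sqcup\!\sqcup}$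 is the shuffle product (the sum of all shuffles, with multiplicity). For a word $w=w_1\cdots w_r$ let $\mathcal D(w)=\{i: w_i>w_{i+1}\}$ and $$f_{\mathcal D(w)}=\sum_{\substack{i_1\le\cdots\le i_r\\ i_j<i_{j+1}\text{ if }j\in\mathcal D(w)}}x_{i_1}\cdots x_{i_r}.$$ Let $\mathrm{QSym}$ be the algebra of real quasisymmetric formal power series in $x_1,x_2,\dots$ (series, possibly of unbounded degree, in which for all $i_1<\dots<i_k$, $j_1<\dots<j_k$ and exponents $a_1,\dots,a_k$ the coefficients of $x_{i_1}^{a_1}\cdots x_{i_k}^{a_k}$ and $x_{j_1}^{a_1}\cdots x_{j_k}^{a_k}$ agree). **Theorem.** The space $SKPR$ is closed under the product, and so is an associative (non-unital) real algebra. There is a unique linear map $\phi:SKPR\to\mathrm{QSym}$ with $$\phi([[h]])=\sum_{w\,\hat\equiv\,h}f_{\mathcal D(w)}$$ for every initial word $h$ (each monomial occurs in only finitely many terms of this sum), and $\phi$ is an algebra homomorphism: $\phi(xy)=\phi(x)\phi(y)$ for all $x,y\in SKPR$. -/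

import Mathlib

/-- Words in the positive integers. -/
abbrev Word : Type := List ℕ+

namespace Word

/-- The elementary weak K-Knuth moves. -/
inductive WeakKKnuthStep : Word → Word → Prop
  | idem (u v : Word) (a : ℕ+) :
      WeakKKnuthStep (u ++ [a, a] ++ v) (u ++ [a] ++ v)
  | braid (u v : Word) (a b : ℕ+) (hab : a < b) :
      WeakKKnuthStep (u ++ [a, b, a] ++ v) (u ++ [b, a, b] ++ v)
  | bac (u v : Word) (a b c : ℕ+) (hab : a < b) (hbc : b < c) :
      WeakKKnuthStep (u ++ [b, a, c] ++ v) (u ++ [b, c, a] ++ v)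
  | acb (u v : Word) (a b c : ℕ+) (hab : a < b) (hbc : b < c) :
      WeakKKnuthStep (u ++ [a, c, b] ++ v) (u ++ [c, a, b] ++ v)
  | swap (u : Word) (a b : ℕ+) (hab : a < b) :
      WeakKKnuthStep ([a, b] ++ u) ([b, a] ++ u)

/-- Weak K-Knuth equivalence of words. -/
def WeakKKnuth : Word → Word → Prop := Relation.EqvGen WeakKKnuthStep

/-- A word is initial if its set of letters is `{1, …, k}` for some positive integer `k`. -/
def IsInitial (h : Word) : Prop := ∃ k : ℕ+, ∀ a : ℕ+, a ∈ h ↔ a ≤ k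

/-- The largest letter of a word (`0` for the empty word). -/
def maxLetter : Word → ℕ
  | [] => 0
  | a :: w => max (a : ℕ) (maxLetter w)

/-- `a + n` as a positive integer. -/
def shiftLetter (n : ℕ) (a : ℕ+) : ℕ+ := ⟨(a : ℕ) + n, Nat.add_pos_left a.2 n⟩

/-- The word `w[n]`: every letter of `w` is increased by `n`. -/
def shift (n : ℕ) (w : Word) : Word := w.map (shiftLetter n)

/-- The shuffles of two words, with multiplicity. -/
def shuffle : Word → Word → Multiset Word
  | [], v => {v}
  | a :: u, [] => {a :: u}
  | a :: u, b :: v =>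
      (shuffle u (b :: v)).map (List.cons a) + (shuffle (a :: u) v).map (List.cons b)
termination_by u v => u.length + v.length

/-- The descent set `{i : w_i > w_{i+1}}`, with positions counted from `0`. -/
def descentSet (w : Word) : Set ℕ :=
  {i | ∃ h : i + 1 < w.length, w[i + 1] < w[i]}

/-! ### Auxiliary facts on shuffles -/

theorem shuffle_nil_right (u : Word) : shuffle u [] = {u} := by
  cases u <;> simp [shuffle]

theorem shuffle_nil_left (u : Word) : shuffle [] u = {u} := by
  simp [shuffle]

theorem shuffle_cons_cons (a b : ℕ+) (u v : Word) :
    shuffle (a :: u) (b :: v) =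
      (shuffle u (b :: v)).map (List.cons a) + (shuffle (a :: u) v).map (List.cons b) := by
  rw [shuffle]

theorem perm_of_mem_shuffle : ∀ (u v : Word) {w : Word}, w ∈ shuffle u v → w.Perm (u ++ v)
  | [], v, w, h => by
      rw [shuffle_nil_left, Multiset.mem_singleton] at h
      simp [h]
  | a :: u, [], w, h => by
      rw [shuffle_nil_right, Multiset.mem_singleton] at h
      simp [h]
  | a :: u, b :: v, w, h => by
      rw [shuffle_cons_cons, Multiset.mem_add, Multiset.mem_map, Multiset.mem_map] at h
      rcases h with ⟨x, hx, rfl⟩ | ⟨x, hx, rfl⟩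
      · exact (perm_of_mem_shuffle u (b :: v) hx).cons a
      · exact ((perm_of_mem_shuffle (a :: u) v hx).cons b).trans List.perm_middle.symm
termination_by u v => u.length + v.length

theorem shuffle_assoc : ∀ a b c : Word,
    (shuffle a b).bind (fun v => shuffle v c) = (shuffle b c).bind (fun v => shuffle a v)
  | [], b, c => by
      have : (shuffle b c).bind (fun v => ({v} : Multiset Word)) = shuffle b c := by
        rw [Multiset.bind_singleton, Multiset.map_id']
      simp [shuffle_nil_left, this]
  | x :: a, [], c => by simp [shuffle_nil_left, shuffle_nil_right]
  | x :: a, y :: b, [] => by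
      have : (shuffle (x :: a) (y :: b)).bind (fun v => ({v} : Multiset Word)) =
          shuffle (x :: a) (y :: b) := by
        rw [Multiset.bind_singleton, Multiset.map_id']
      simp [shuffle_nil_right, this]
  | x :: a, y :: b, z :: c => by
      have h1 := shuffle_assoc a (y :: b) (z :: c)
      have h2 := shuffle_assoc (x :: a) b (z :: c)
      have h3 := shuffle_assoc (x :: a) (y :: b) c
      rw [shuffle_cons_cons y z b c, Multiset.add_bind, Multiset.bind_map,
        Multiset.bind_map] at h1
      rw [shuffle_cons_cons x y a b, Multiset.add_bind, Multiset.bind_map,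
        Multiset.bind_map] at h3
      rw [shuffle_cons_cons x y a b, shuffle_cons_cons y z b c]
      simp only [Multiset.add_bind, Multiset.bind_map, shuffle_cons_cons, Multiset.bind_add,
        ← Multiset.map_bind]
      rw [h1, h2, ← h3]
      simp only [Multiset.map_add]
      abel
termination_by a b c => a.length + b.length + c.length

theorem coe_shiftLetter (n : ℕ) (a : ℕ+) : (shiftLetter n a : ℕ) = (a : ℕ) + n := rfl

theorem shiftLetter_injective (n : ℕ) : Function.Injective (shiftLetter n) := by
  intro a b h
  have := congrArg (fun x : ℕ+ => (x : ℕ)) h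
  simp only [coe_shiftLetter] at this
  exact PNat.eq (by omega)

theorem shift_injective (n : ℕ) : Function.Injective (shift n) :=
  List.map_injective_iff.mpr (shiftLetter_injective n)

theorem shift_shift (m n : ℕ) (w : Word) : shift m (shift n w) = shift (m + n) w := by
  simp only [shift, List.map_map]
  congr 1
  funext a
  apply PNat.eq
  simp only [Function.comp, coe_shiftLetter]
  omega

theorem shuffle_shift (n : ℕ) : ∀ u v : Word,
    shuffle (shift n u) (shift n v) = (shuffle u v).map (shift n)
  | [], v => by simp [shift, shuffle_nil_left]
  | a :: u, [] => by simp [shift, shuffle_nil_right]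
  | a :: u, b :: v => by
      have h1 := shuffle_shift n u (b :: v)
      have h2 := shuffle_shift n (a :: u) v
      simp only [shift, List.map_cons] at h1 h2 ⊢
      rw [shuffle_cons_cons, shuffle_cons_cons, h1, h2]
      simp only [Multiset.map_add, Multiset.map_map]
      rfl
termination_by u v => u.length + v.length

theorem maxLetter_le_iff (w : Word) (n : ℕ) : maxLetter w ≤ n ↔ ∀ a ∈ w, (a : ℕ) ≤ n := by
  induction w with
  | nil => simp [maxLetter]
  | cons a w ih => simp [maxLetter, ih]

theorem maxLetter_le_shift (n : ℕ) (w : Word) : maxLetter w ≤ maxLetter (shift n w) := by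
  rw [maxLetter_le_iff]
  intro a ha
  have := (maxLetter_le_iff (shift n w) _).1 le_rfl (shiftLetter n a) (List.mem_map_of_mem ha)
  simp only [coe_shiftLetter] at this
  omega

theorem maxLetter_shuffle {u v w : Word} (h : w ∈ shuffle u v) :
    maxLetter w = max (maxLetter u) (maxLetter v) := by
  refine eq_of_forall_ge_iff fun n => ?_
  have hp := perm_of_mem_shuffle u v h
  rw [max_le_iff, maxLetter_le_iff, maxLetter_le_iff, maxLetter_le_iff]
  simp only [hp.mem_iff, List.mem_append]
  constructor
  · intro H
    exact ⟨fun a ha => H a (Or.inl ha), fun a ha => H a (Or.inr ha)⟩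
  · rintro ⟨H1, H2⟩ a (ha | ha)
    · exact H1 a ha
    · exact H2 a ha

theorem max_maxLetter_shift (n : ℕ) (w : Word) :
    max n (maxLetter (shift n w)) = n + maxLetter w := by
  induction w with
  | nil => simp [shift, maxLetter]
  | cons a w ih =>
      simp only [shift, List.map_cons, maxLetter, coe_shiftLetter] at ih ⊢
      omega

end Word

/-- Formal, possibly infinite, real linear combinations of words. -/
def WordSeries : Type := Word → ℝ

namespace WordSeries

open Word

noncomputable instance : AddCommGroup WordSeries := inferInstanceAs (AddCommGroup (Word → ℝ))

noncomputable instance : Module ℝ WordSeries := inferInstanceAs (Module ℝ (Word → ℝ))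

@[ext] theorem ext {F G : WordSeries} (h : ∀ u, F u = G u) : F = G := funext h

/-- The multiplicity of `u` in the shifted shuffle of `w` and `w'[n]`, `n` the largest letter
of `w`. -/
def shuffleCoeff (w w' u : Word) : ℕ := (shuffle w (shift (maxLetter w) w')).count u

/-- The bilinear extension to formal sums of words of
`(w, w') ↦ w ⧢ w'[n]`, where `n` is the largest letter of `w`. For a fixed word `u` only
finitely many pairs `(w, w')` contribute. -/
noncomputable instance : Mul WordSeries where
  mul F G := fun u => ∑ᶠ p : Word × Word, F p.1 * G p.2 * (shuffleCoeff p.1 p.2 u : ℝ)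

theorem mul_apply (F G : WordSeries) (u : Word) :
    (F * G) u = ∑ᶠ p : Word × Word, F p.1 * G p.2 * (shuffleCoeff p.1 p.2 u : ℝ) := rfl

/-- Words of length at most `L` with letters at most `M`. -/
def boundedWords (L M : ℕ) : Set Word := {w | w.length ≤ L ∧ maxLetter w ≤ M}

theorem boundedWords_finite (L M : ℕ) : (boundedWords L M).Finite := by
  have hA : {a : ℕ+ | (a : ℕ) ≤ M}.Finite :=
    (Set.finite_Iic M).preimage (PNat.coe_injective.injOn)
  have : Finite {a : ℕ+ | (a : ℕ) ≤ M} := hA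
  have hf := List.finite_length_le {a : ℕ+ | (a : ℕ) ≤ M} L
  refine (hf.image (List.map Subtype.val)).subset ?_
  rintro w ⟨h1, h2⟩
  rw [maxLetter_le_iff] at h2
  refine ⟨w.attach.map (fun a => ⟨a.1, h2 a.1 a.2⟩), ?_, ?_⟩
  · change List.length _ ≤ L
    simpa using h1
  · simp [List.map_map, Function.comp_def]

theorem mem_bounded_of_ne {w w' u : Word} {L M : ℕ} (hu : u ∈ boundedWords L M)
    (h : shuffleCoeff w w' u ≠ 0) : w ∈ boundedWords L M ∧ w' ∈ boundedWords L M := by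
  have hm : u ∈ shuffle w (shift (maxLetter w) w') := Multiset.count_ne_zero.1 h
  have hp := (perm_of_mem_shuffle _ _ hm).length_eq
  have hx := maxLetter_shuffle hm
  have hs := maxLetter_le_shift (maxLetter w) w'
  have hl : (shift (maxLetter w) w').length = w'.length := by simp [shift]
  obtain ⟨h1, h2⟩ := hu
  rw [List.length_append] at hp
  exact ⟨⟨by omega, by omega⟩, ⟨by omega, by omega⟩⟩

theorem support_subset (F G : WordSeries) {u : Word} {L M : ℕ} (hu : u ∈ boundedWords L M) :
    Function.support (fun p : Word × Word => F p.1 * G p.2 * (shuffleCoeff p.1 p.2 u : ℝ)) ⊆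
      ((boundedWords_finite L M).toFinset ×ˢ (boundedWords_finite L M).toFinset :
        Finset (Word × Word)) := by
  intro p hp
  have : shuffleCoeff p.1 p.2 u ≠ 0 := by
    intro h
    apply hp
    simp [h]
  simpa using mem_bounded_of_ne hu this

theorem mul_apply_eq_sum (F G : WordSeries) {u : Word} {L M : ℕ} (hu : u ∈ boundedWords L M) :
    (F * G) u = ∑ w ∈ (boundedWords_finite L M).toFinset,
      ∑ w' ∈ (boundedWords_finite L M).toFinset, F w * G w' * (shuffleCoeff w w' u : ℝ) := by
  rw [mul_apply, finsum_eq_sum_of_support_subset _ (support_subset F G hu),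
    Finset.sum_product]

theorem self_mem_boundedWords (u : Word) : u ∈ boundedWords u.length (maxLetter u) :=
  ⟨le_rfl, le_rfl⟩

theorem bind_shuffle_eq (a b c : Word) :
    (shuffle a (shift (maxLetter a) b)).bind (fun v => shuffle v (shift (maxLetter v) c)) =
      (shuffle b (shift (maxLetter b) c)).bind
        (fun v => shuffle a (shift (maxLetter a) v)) := by
  have h1 : (shuffle a (shift (maxLetter a) b)).bind
      (fun v => shuffle v (shift (maxLetter v) c)) =
      (shuffle a (shift (maxLetter a) b)).bind
        (fun v => shuffle v (shift (maxLetter a + maxLetter b) c)) := by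
    refine Multiset.bind_congr fun v hv => ?_
    rw [maxLetter_shuffle hv, max_maxLetter_shift]
  rw [h1, shuffle_assoc, ← shift_shift, shuffle_shift, Multiset.bind_map]

theorem sum_shuffleCoeff {S : Finset Word} {m : Multiset Word} {g : Word → ℕ}
    (h : ∀ v, m.count v * g v ≠ 0 → v ∈ S) :
    ∑ v ∈ S, m.count v * g v = (m.map g).sum := by
  rw [Finset.sum_multiset_map_count]
  simp only [smul_eq_mul]
  have h2 : ∑ v ∈ S, m.count v * g v = ∑ v ∈ S ∪ m.toFinset, m.count v * g v := by
    refine Finset.sum_subset Finset.subset_union_left fun v _ hv => ?_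
    by_contra h'
    exact hv (h v h')
  rw [h2]
  symm
  refine Finset.sum_subset Finset.subset_union_right fun v _ hv => ?_
  rw [Multiset.mem_toFinset] at hv
  simp [Multiset.count_eq_zero_of_notMem hv]

theorem shuffleCoeff_assoc (a b c u : Word) {L M : ℕ} (hu : u ∈ boundedWords L M) :
    ∑ v ∈ (boundedWords_finite L M).toFinset, shuffleCoeff a b v * shuffleCoeff v c u =
      ∑ v ∈ (boundedWords_finite L M).toFinset, shuffleCoeff b c v * shuffleCoeff a v u := by
  have key := congrArg (Multiset.count u) (bind_shuffle_eq a b c)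
  rw [Multiset.count_bind, Multiset.count_bind] at key
  have e1 := sum_shuffleCoeff (S := (boundedWords_finite L M).toFinset)
    (m := shuffle a (shift (maxLetter a) b)) (g := fun v => shuffleCoeff v c u) (by
      intro v hv
      simpa using (mem_bounded_of_ne hu (right_ne_zero_of_mul hv)).1)
  have e2 := sum_shuffleCoeff (S := (boundedWords_finite L M).toFinset)
    (m := shuffle b (shift (maxLetter b) c)) (g := fun v => shuffleCoeff a v u) (by
      intro v hv
      simpa using (mem_bounded_of_ne hu (right_ne_zero_of_mul hv)).2)
  exact e1.trans (key.trans e2.symm)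

/-- With the shifted shuffle product, formal sums of words form an associative ring. -/
noncomputable instance : NonUnitalRing WordSeries where
  left_distrib F G H := by
    ext u
    change (F * (G + H)) u = (F * G) u + (F * H) u
    simp only [mul_apply_eq_sum _ _ (self_mem_boundedWords u), ← Finset.sum_add_distrib]
    refine Finset.sum_congr rfl fun w _ => Finset.sum_congr rfl fun w' _ => ?_
    change F w * (G w' + H w') * _ = _
    ring
  right_distrib F G H := by
    ext u
    change ((F + G) * H) u = (F * H) u + (G * H) u
    simp only [mul_apply_eq_sum _ _ (self_mem_boundedWords u), ← Finset.sum_add_distrib]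
    refine Finset.sum_congr rfl fun w _ => Finset.sum_congr rfl fun w' _ => ?_
    change (F w + G w) * H w' * _ = _
    ring
  zero_mul F := by
    ext u
    rw [mul_apply]
    change (∑ᶠ p : Word × Word, (0 : ℝ) * _ * _) = (0 : ℝ)
    simp
  mul_zero F := by
    ext u
    rw [mul_apply]
    change (∑ᶠ p : Word × Word, _ * (0 : ℝ) * _) = (0 : ℝ)
    simp
  mul_assoc F G H := by
    ext u
    have hu := self_mem_boundedWords u
    set S := (boundedWords_finite u.length (maxLetter u)).toFinset with hS
    have hl : (F * G * H) u = ∑ a ∈ S, ∑ b ∈ S, ∑ c ∈ S, F a * G b * H c *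
        ((∑ v ∈ S, shuffleCoeff a b v * shuffleCoeff v c u : ℕ) : ℝ) := by
      have h0 : (F * G * H) u = ∑ v ∈ S, ∑ c ∈ S, ∑ a ∈ S, ∑ b ∈ S,
          F a * G b * H c * ((shuffleCoeff a b v : ℝ) * (shuffleCoeff v c u : ℝ)) := by
        rw [mul_apply_eq_sum _ _ hu]
        refine Finset.sum_congr rfl fun v hv => Finset.sum_congr rfl fun c _ => ?_
        rw [mul_apply_eq_sum F G (by simpa [hS] using hv), Finset.sum_mul, Finset.sum_mul]
        refine Finset.sum_congr rfl fun a _ => ?_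
        rw [Finset.sum_mul, Finset.sum_mul]
        refine Finset.sum_congr rfl fun b _ => ?_
        ring
      rw [h0, Finset.sum_congr rfl fun v _ => Finset.sum_comm, Finset.sum_comm]
      refine Finset.sum_congr rfl fun a _ => ?_
      rw [Finset.sum_congr rfl fun v _ => Finset.sum_comm, Finset.sum_comm]
      refine Finset.sum_congr rfl fun b _ => ?_
      rw [Finset.sum_comm]
      refine Finset.sum_congr rfl fun c _ => ?_
      push_cast
      rw [Finset.mul_sum]
    have hr : (F * (G * H)) u = ∑ a ∈ S, ∑ b ∈ S, ∑ c ∈ S, F a * G b * H c *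
        ((∑ v ∈ S, shuffleCoeff b c v * shuffleCoeff a v u : ℕ) : ℝ) := by
      have h0 : (F * (G * H)) u = ∑ a ∈ S, ∑ v ∈ S, ∑ b ∈ S, ∑ c ∈ S,
          F a * G b * H c * ((shuffleCoeff b c v : ℝ) * (shuffleCoeff a v u : ℝ)) := by
        rw [mul_apply_eq_sum _ _ hu]
        refine Finset.sum_congr rfl fun a _ => Finset.sum_congr rfl fun v hv => ?_
        rw [mul_apply_eq_sum G H (by simpa [hS] using hv), Finset.mul_sum, Finset.sum_mul]
        refine Finset.sum_congr rfl fun b _ => ?_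
        rw [Finset.mul_sum, Finset.sum_mul]
        refine Finset.sum_congr rfl fun c _ => ?_
        ring
      rw [h0]
      refine Finset.sum_congr rfl fun a _ => ?_
      rw [Finset.sum_comm]
      refine Finset.sum_congr rfl fun b _ => ?_
      rw [Finset.sum_comm]
      refine Finset.sum_congr rfl fun c _ => ?_
      push_cast
      rw [Finset.mul_sum]
    rw [hl, hr]
    refine Finset.sum_congr rfl fun a _ => Finset.sum_congr rfl fun b _ =>
      Finset.sum_congr rfl fun c _ => ?_
    rw [shuffleCoeff_assoc a b c u hu]

instance : IsScalarTower ℝ WordSeries WordSeries where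
  smul_assoc r F G := by
    ext u
    change ((r • F) * G) u = r * (F * G) u
    simp only [mul_apply_eq_sum _ _ (self_mem_boundedWords u), Finset.mul_sum]
    refine Finset.sum_congr rfl fun w _ => Finset.sum_congr rfl fun w' _ => ?_
    change (r * F w) * G w' * _ = _
    ring

instance : SMulCommClass ℝ WordSeries WordSeries where
  smul_comm r F G := by
    ext u
    change r * (F * G) u = (F * (r • G)) u
    simp only [mul_apply_eq_sum _ _ (self_mem_boundedWords u), Finset.mul_sum]
    refine Finset.sum_congr rfl fun w _ => Finset.sum_congr rfl fun w' _ => ?_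
    change _ = F w * (r * G w') * _
    ring

open Classical in
/-- `[[h]]`: the formal sum of all words in the weak K-Knuth class of `h`. -/
noncomputable def wordClass (h : Word) : WordSeries := fun w => if WeakKKnuth h w then 1 else 0

end WordSeries

/-- The real vector space spanned by the sums `[[h]]`, `h` an initial word. -/
noncomputable def SKPR : Submodule ℝ WordSeries :=
  Submodule.span ℝ {F | ∃ h : Word, Word.IsInitial h ∧ F = WordSeries.wordClass h}

/-- A power series in `x_1, x_2, …` is quasisymmetric if for all `i_1 < ⋯ < i_k`,
`j_1 < ⋯ < j_k` and all exponents `a_1, …, a_k` the coefficients of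
`x_{i_1}^{a_1} ⋯ x_{i_k}^{a_k}` and `x_{j_1}^{a_1} ⋯ x_{j_k}^{a_k}` agree. -/
def IsQuasisymmetric (F : MvPowerSeries ℕ+ ℝ) : Prop :=
  ∀ (k : ℕ) (i j : Fin k ↪o ℕ+) (a : Fin k →₀ ℕ),
    MvPowerSeries.coeff (a.embDomain i.toEmbedding) F =
      MvPowerSeries.coeff (a.embDomain j.toEmbedding) F

theorem coeff_embDomain_mul (F G : MvPowerSeries ℕ+ ℝ) {k : ℕ} (i : Fin k ↪o ℕ+)
    (a : Fin k →₀ ℕ) :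
    MvPowerSeries.coeff (a.embDomain i.toEmbedding) (F * G) =
      ∑ p ∈ Finset.HasAntidiagonal.antidiagonal a, MvPowerSeries.coeff (p.1.embDomain i.toEmbedding) F *
        MvPowerSeries.coeff (p.2.embDomain i.toEmbedding) G := by
  classical
  rw [MvPowerSeries.coeff_mul]
  symm
  refine Finset.sum_bij
    (fun p _ => (p.1.embDomain i.toEmbedding, p.2.embDomain i.toEmbedding)) ?_ ?_ ?_ ?_
  · intro p hp
    rw [Finset.HasAntidiagonal.mem_antidiagonal] at hp ⊢
    rw [← hp]
    exact (Finsupp.embDomain_add _ _ _).symm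
  · intro p _ q _ h
    rw [Prod.mk.injEq] at h
    exact Prod.ext (Finsupp.embDomain_injective _ h.1) (Finsupp.embDomain_injective _ h.2)
  · rintro ⟨x, y⟩ h
    rw [Finset.HasAntidiagonal.mem_antidiagonal] at h
    have hz : ∀ t : ℕ+, t ∉ Set.range i → x t = 0 ∧ y t = 0 := by
      intro t ht
      have h1 : x t + y t = 0 := by
        have h2 := DFunLike.congr_fun h t
        rw [Finsupp.embDomain_of_notMem_range _ _ _ ht] at h2
        exact h2
      omega
    have hx : ∀ z : ℕ+ →₀ ℕ, (∀ t : ℕ+, t ∉ Set.range i → z t = 0) →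
        (z.comapDomain i i.injective.injOn).embDomain i.toEmbedding = z := by
      intro z hz
      ext t
      by_cases ht : t ∈ Set.range i
      · obtain ⟨s, rfl⟩ := ht
        exact Finsupp.embDomain_apply_self i.toEmbedding _ s
      · rw [hz t ht]
        exact Finsupp.embDomain_of_notMem_range _ _ _ ht
    refine ⟨(x.comapDomain i i.injective.injOn, y.comapDomain i i.injective.injOn), ?_, ?_⟩
    · rw [Finset.HasAntidiagonal.mem_antidiagonal]
      ext s
      have h2 := DFunLike.congr_fun h (i s)
      exact h2.trans (Finsupp.embDomain_apply_self i.toEmbedding a s)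
    · exact Prod.ext (hx x fun t ht => (hz t ht).1) (hx y fun t ht => (hz t ht).2)
  · intro p _
    rfl

/-- The algebra of real quasisymmetric functions, as power series in `x_1, x_2, …`; the degree
is not required to be bounded, so that infinite sums of fundamental quasisymmetric functions
of increasing degree are allowed. -/
noncomputable def QSym : Subalgebra ℝ (MvPowerSeries ℕ+ ℝ) where
  carrier := {F | IsQuasisymmetric F}
  mul_mem' := by
    intro F G hF hG k i j a
    rw [coeff_embDomain_mul, coeff_embDomain_mul]
    exact Finset.sum_congr rfl fun p _ => by rw [hF k i j p.1, hG k i j p.2]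
  add_mem' := by
    intro F G hF hG k i j a
    rw [map_add, map_add, hF k i j a, hG k i j a]
  algebraMap_mem' := by
    classical
    intro r k i j a
    rw [MvPowerSeries.algebraMap_apply, MvPowerSeries.coeff_C, MvPowerSeries.coeff_C]
    simp [Finsupp.embDomain_eq_zero]

/-- The fundamental quasisymmetric function `f_D` of degree `n`: the sum of the monomials
`x_{s_1} ⋯ x_{s_n}` over all sequences `s_1 ≤ ⋯ ≤ s_n` of positive integers that increase
strictly at the positions in `D` (counted from `0`). -/
noncomputable def fundamental (n : ℕ) (D : Set ℕ) : MvPowerSeries ℕ+ ℝ := fun m =>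
  (Set.ncard {s : Fin n → ℕ+ | Monotone s ∧
    (∀ (j : ℕ) (hj : j + 1 < n), j ∈ D → s ⟨j, by omega⟩ < s ⟨j + 1, hj⟩) ∧
    ∑ t, Finsupp.single (s t) 1 = m} : ℝ)

/-- `f_{D(w)}`. -/
noncomputable def fundamentalOfWord (w : Word) : MvPowerSeries ℕ+ ℝ :=
  fundamental w.length (Word.descentSet w)

/-- `F` is the formal sum of the family `f`: every monomial occurs in only finitely many
members, and the coefficients of `F` are the sums of their coefficients. -/
def HasFormalSum {ι : Type*} (f : ι → MvPowerSeries ℕ+ ℝ) (F : MvPowerSeries ℕ+ ℝ) : Prop :=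
  ∀ m : ℕ+ →₀ ℕ, {i | MvPowerSeries.coeff m (f i) ≠ 0}.Finite ∧
    MvPowerSeries.coeff m F = ∑ᶠ i, MvPowerSeries.coeff m (f i)

/-! ### Finitely many classes over a bounded alphabet -/

namespace Word

/-! Product. The letters of `w` are at most `n` and those of `w'[n]` exceed `n`, so a word `u`
occurs at most once in their shuffles, and only when `w` and `w'` are its restrictions to the
letters up to `n` and, shifted down, above `n` (`count_shuffle_shift`). Hence the product of two
classes is the multiplicity-free sum of the words whose two restrictions lie in the two classes
(`wordClass_mul_wordClass`). Restriction to an interval of letters respects the equivalence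
(`WeakKKnuth.filterMap`), so this set of words is a union of classes, all of them initial.

To lie in the span, the union must be finite. In fact a bounded alphabet has only finitely many
classes (`exists_finite_representatives`): two occurrences of the largest letter `N` can be merged
(`exists_merge`), so every word reduces to `u` or `u N u'` with smaller letters in `u` and `u'`, and
induction on `N` applies.

Homomorphism. A monomial of `f_{D(w)}` is encoded as a multiset of pairs which, in lexicographic
order, has lower row `w` and upper row the monomial: lexicographic order forces a strict increase
above exactly at the descents of `w`. The two rows determine the multiset, so a coefficient of the
image of a class counts multisets with given upper row and with lower row in the class
(`coeff_fundamentalSum_indicator`). Cutting a multiset at the lower entry `n` restricts its lower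
row, and is undone by a shifted union, so the counts for a product are the convolution of the counts
for the factors (`pairsOver_productSet_ncard`). All sums are finite because the degree fixes the
length of the word and letters are bounded; bilinearity does the rest. -/

theorem WeakKKnuth.refl (w : Word) : WeakKKnuth w w := Relation.EqvGen.refl w

theorem WeakKKnuth.symm {u v : Word} (h : WeakKKnuth u v) : WeakKKnuth v u :=
  Relation.EqvGen.symm _ _ h

theorem WeakKKnuth.trans {u v w : Word} (h : WeakKKnuth u v) (h' : WeakKKnuth v w) :
    WeakKKnuth u w := Relation.EqvGen.trans _ _ _ h h'

/-- Two words are interchangeable if replacing one by the other anywhere inside a word does not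
change its weak K-Knuth class. -/
def Interchangeable (x y : Word) : Prop := ∀ p s : Word, WeakKKnuth (p ++ x ++ s) (p ++ y ++ s)

namespace Interchangeable

theorem refl (x : Word) : Interchangeable x x := fun _ _ => WeakKKnuth.refl _

theorem symm {x y : Word} (h : Interchangeable x y) : Interchangeable y x :=
  fun p s => (h p s).symm

theorem trans {x y z : Word} (h : Interchangeable x y) (h' : Interchangeable y z) :
    Interchangeable x z := fun p s => (h p s).trans (h' p s)

theorem append_left {x y : Word} (h : Interchangeable x y) (p : Word) :
    Interchangeable (p ++ x) (p ++ y) := fun q s => by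
  simpa only [List.append_assoc] using h (q ++ p) s

theorem append_right {x y : Word} (h : Interchangeable x y) (s : Word) :
    Interchangeable (x ++ s) (y ++ s) := fun q t => by
  simpa only [List.append_assoc] using h q (s ++ t)

theorem cons {x y : Word} (h : Interchangeable x y) (a : ℕ+) :
    Interchangeable (a :: x) (a :: y) := h.append_left [a]

/-- The finiteness argument needs a congruence. The move `swap` acts only at the front of a word, so
substitution inside a word relies on the other four moves. -/
theorem append {x y x' y' : Word} (h : Interchangeable x y) (h' : Interchangeable x' y') :
    Interchangeable (x ++ x') (y ++ y') := (h.append_right x').trans (h'.append_left y)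

theorem weakKKnuth {x y : Word} (h : Interchangeable x y) : WeakKKnuth x y := by
  simpa using h [] []

theorem idem (a : ℕ+) : Interchangeable [a, a] [a] := fun u v =>
  .rel _ _ (.idem u v a)

theorem braid {a b : ℕ+} (h : a < b) : Interchangeable [a, b, a] [b, a, b] := fun u v =>
  .rel _ _ (.braid u v a b h)

theorem bac {a b c : ℕ+} (h : a < b) (h' : b < c) : Interchangeable [b, a, c] [b, c, a] :=
  fun u v => .rel _ _ (.bac u v a b c h h')

theorem acb {a b c : ℕ+} (h : a < b) (h' : b < c) : Interchangeable [a, c, b] [c, a, b] :=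
  fun u v => .rel _ _ (.acb u v a b c h h')

/-- In a decreasing word followed by `a < b`, with `b` smaller than the last letter of the
decreasing part, the letter `a` moves to the front. -/
theorem move_front {a b : ℕ+} (hab : a < b) : ∀ {x : Word}, (x ++ [b]).Pairwise (· > ·) →
    Interchangeable (x ++ [a, b]) (a :: (x ++ [b]))
  | [], _ => refl _
  | c :: x, h => by
    have h1 := (move_front hab (x := x) (List.pairwise_cons.1 h).2).cons c
    -- After the inductive step the word begins `c a d`, and `a < d < c` permits `c a d ∼ a c d`.
    obtain ⟨d, t, hd⟩ : ∃ d t, x ++ [b] = d :: t := List.exists_cons_of_ne_nil (by simp)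
    have hdc : d < c := (List.pairwise_cons.1 h).1 d (by simp [hd])
    have had : a < d := by
      have h2 := (List.pairwise_cons.1 h).2
      rcases x with _ | ⟨e, x⟩
      · simp at hd; rw [← hd.1]; exact hab
      · simp only [List.cons_append, List.cons.injEq] at hd
        rw [← hd.1]
        exact hab.trans ((List.pairwise_cons.1 h2).1 b (by simp))
    refine h1.trans ?_
    simp only [List.cons_append, hd]
    exact ((acb had hdc).symm.append_right t)

end Interchangeable

/-- The word starts with an ascent. -/
def StartsWithAscent (w : Word) : Prop := ∃ a b t, a < b ∧ w = a :: b :: t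

/-- A strictly decreasing word of length at least two followed by an ascent is interchangeable
with a word of the same length and with the same letters that starts with an ascent. -/
theorem exists_startsWithAscent : ∀ (x : Word) (c a y : ℕ+),
    (x ++ [c, a]).Pairwise (· > ·) → a < y →
    ∃ w : Word, StartsWithAscent w ∧ w.length = x.length + 3 ∧ w ⊆ x ++ [c, a, y] ∧
      Interchangeable (x ++ [c, a, y]) w := by
  intro x
  induction x using List.reverseRecOn with
  | nil =>
    intro c a y h hy
    have hac : a < c := by simpa using h
    -- `c a y` becomes `a c y`, `a y a` or `c y a`, according to how `y` compares with `c`.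
    rcases lt_trichotomy y c with h' | rfl | h'
    · exact ⟨[a, c, y], ⟨a, c, [y], hac, rfl⟩, rfl, by simp, (Interchangeable.acb hy h').symm⟩
    · exact ⟨[a, y, a], ⟨a, y, [a], hy, rfl⟩, rfl, by simp, (Interchangeable.braid hy).symm⟩
    · exact ⟨[c, y, a], ⟨c, y, [a], h', rfl⟩, rfl, by simp, Interchangeable.bac hac h'⟩
  | append_singleton x d ih =>
    intro c a y h hy
    have hac : a < c := by
      have := (List.pairwise_append.1 h).2.1
      simpa using this
    have hxc : (x ++ [d] ++ [c]).Pairwise (· > ·) :=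
      h.sublist (List.Sublist.append_left (by simp) _)
    have front := Interchangeable.move_front hac hxc
    obtain ⟨e, t, he⟩ : ∃ e t, x ++ [d] ++ [c] = e :: t :=
      List.exists_cons_of_ne_nil (by simp)
    have hae : a < e := by
      rcases List.mem_append.1 (he ▸ List.mem_cons_self : e ∈ x ++ [d] ++ [c]) with h1 | h1
      · exact (List.pairwise_append.1 h).2.2 e h1 a (by simp)
      · simp at h1; rwa [h1]
    -- If `y ≤ c`, the same move puts `a` before `c`, and `a` then travels to the front. If `y > c`,
    -- then `c a y ∼ c y a` exposes the shorter word `x d c y`, to which the induction hypothesis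
    -- applies.
    rcases lt_trichotomy y c with h' | rfl | h'
    · refine ⟨a :: (x ++ [d] ++ [c]) ++ [y], ⟨a, e, t ++ [y], hae, by simp [he]⟩, by simp, ?_, ?_⟩
      · intro z; simp; tauto
      · have := (Interchangeable.acb hy h').symm.append_left (x ++ [d])
        refine this.trans ?_
        have := front.append_right [y]
        simpa using this
    · refine ⟨a :: (x ++ [d] ++ [y]) ++ [a], ⟨a, e, t ++ [a], hae, by simp [he]⟩, by simp, ?_, ?_⟩
      · intro z; simp; tauto
      · have := (Interchangeable.braid hy).symm.append_left (x ++ [d])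
        refine this.trans ?_
        have := front.append_right [a]
        simpa using this
    · obtain ⟨w, ⟨p, q, t, hpq, rfl⟩, hl, hs, hc⟩ := ih d c y (by simpa using hxc) h'
      refine ⟨p :: q :: t ++ [a], ⟨p, q, t ++ [a], hpq, by simp⟩, by simpa using hl, ?_, ?_⟩
      · intro z hz
        rcases List.mem_append.1 hz with hz | hz
        · have := hs hz
          simp at this ⊢; tauto
        · simp at hz ⊢; tauto
      · have := (Interchangeable.bac hac h').append_left (x ++ [d])
        refine this.trans ?_
        have := hc.append_right [a]
        simpa using this

/-- A word is strictly decreasing, or has two equal adjacent letters after an initial decreasing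
run, or has an ascent after such a run. -/
theorem decreasing_or_exists_run : ∀ w : Word, w.Pairwise (· > ·) ∨
    ∃ x a y s, w = x ++ a :: y :: s ∧ (x ++ [a]).Pairwise (· > ·) ∧ a ≤ y := by
  intro w
  induction w using List.reverseRecOn with
  | nil => simp
  | append_singleton w b ih =>
    rcases ih with h | ⟨x, a, y, s, rfl, h⟩
    · rcases List.eq_nil_or_concat w with rfl | ⟨x, a, rfl⟩
      · simp
      · rcases lt_or_ge b a with hb | hb
        · left
          have : ∀ c ∈ x, a < c := fun c hc =>
            (List.pairwise_append.1 (List.concat_eq_append ▸ h)).2.2 c hc a (List.mem_singleton_self a)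
          rw [List.pairwise_append]
          refine ⟨h, by simp, ?_⟩
          intro c hc d hd
          simp at hd hc
          subst hd
          rcases hc with hc | rfl
          · exact hb.trans (this c hc)
          · exact hb
        · exact Or.inr ⟨x, a, b, [], by simp, by simpa using h, hb⟩
    · exact Or.inr ⟨x, a, y, s ++ [b], by simp, h⟩

/-- Two occurrences of a letter larger than all letters between them can be merged. -/
theorem exists_merge (N : ℕ+) : ∀ (k : ℕ) (v : Word), v.length = k → (∀ a ∈ v, a < N) →
    ∃ u u' : Word, (∀ a ∈ u, a < N) ∧ (∀ a ∈ u', a < N) ∧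
      Interchangeable (N :: v ++ [N]) (u ++ N :: u') := by
  intro k
  induction k using Nat.strong_induction_on with
  | _ k ih =>
  intro v hk hv
  -- Since `a < b < N`, `N a b ⋯ N ∼ a N b ⋯ N`: the left `N` moves inward and leaves a shorter gap.
  have ascent : ∀ w : Word, w.length ≤ k → (∀ a ∈ w, a < N) → StartsWithAscent w →
      ∃ u u' : Word, (∀ a ∈ u, a < N) ∧ (∀ a ∈ u', a < N) ∧
        Interchangeable (N :: w ++ [N]) (u ++ N :: u') := by
    rintro w hw hN ⟨a, b, t, hab, rfl⟩
    obtain ⟨u, u', h1, h2, h3⟩ := ih (t.length + 1) (by simp at hw; omega) (b :: t) rfl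
      (fun c hc => hN c (List.mem_cons_of_mem _ hc))
    refine ⟨a :: u, u', ?_, h2, ?_⟩
    · intro c hc
      rcases List.mem_cons.1 hc with rfl | hc
      · exact hN _ (by simp)
      · exact h1 c hc
    · have := (Interchangeable.acb hab (hN b (by simp))).symm.append_right (t ++ [N])
      refine Interchangeable.trans (by simpa using this) ?_
      simpa using h3.cons a
  -- A decreasing gap of length zero or one closes by `idem` or `braid`; in a longer one the right
  -- `N` moves left past the last letter. An equal adjacent pair is contracted. An ascent after a
  -- decreasing run is first brought to the front, keeping the length.
  rcases decreasing_or_exists_run v with h | ⟨x, a, y, s, rfl, hx, hay⟩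
  · rcases List.eq_nil_or_concat v with rfl | ⟨v, a, rfl⟩
    · exact ⟨[], [], by simp, by simp, Interchangeable.idem N⟩
    rcases List.eq_nil_or_concat v with rfl | ⟨v, b, rfl⟩
    · refine ⟨[a], [a], by simpa using hv, by simpa using hv, ?_⟩
      exact (Interchangeable.braid (hv a (by simp))).symm
    have hab : a < b := by
      rw [List.concat_eq_append, List.concat_eq_append] at h
      exact (List.pairwise_append.1 h).2.2 b (by simp) a (by simp)
    obtain ⟨u, u', h1, h2, h3⟩ := ih (v.length + 1) (by simp at hk; omega) (v ++ [b]) (by simp)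
      (fun c hc => hv c (by simp at hc ⊢; tauto))
    refine ⟨u, u' ++ [a], h1, ?_, ?_⟩
    · intro c hc
      rcases List.mem_append.1 hc with hc | hc
      · exact h2 c hc
      · simp at hc; subst hc; exact hv _ (by simp)
    · have := (Interchangeable.bac hab (hv b (by simp))).append_left (N :: v)
      refine Interchangeable.trans (by simpa using this) ?_
      simpa using h3.append_right [a]
  · rcases hay.eq_or_lt with rfl | hay
    · obtain ⟨u, u', h1, h2, h3⟩ := ih (x.length + 1 + s.length) (by simp at hk; omega)
        (x ++ a :: s) (by simp; omega) (fun c hc => hv c (by simp at hc ⊢; tauto))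
      refine ⟨u, u', h1, h2, Interchangeable.trans ?_ h3⟩
      have := ((Interchangeable.idem a).append_left (N :: x)).append_right (s ++ [N])
      simpa using this
    · rcases List.eq_nil_or_concat x with rfl | ⟨x, c, rfl⟩
      · exact ascent _ hk.le hv ⟨a, y, s, hay, rfl⟩
      · obtain ⟨w, ⟨p, q, t, hpq, rfl⟩, hl, hs, hc⟩ :=
          exists_startsWithAscent x c a y (by simpa using hx) hay
        obtain ⟨u, u', h1, h2, h3⟩ := ascent (p :: q :: t ++ s)
          (by simp at hk hl ⊢; omega)
          (by
            intro z hz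
            refine hv z ?_
            rcases List.mem_append.1 hz with hz | hz
            · have := hs hz
              simp at this ⊢; tauto
            · simp; tauto)
          ⟨p, q, t ++ s, hpq, rfl⟩
        refine ⟨u, u', h1, h2, Interchangeable.trans ?_ h3⟩
        have := (hc.append_left [N]).append_right (s ++ [N])
        simpa using this

/-- Every word with letters at most `N` is interchangeable with a word in which `N` occurs at most
once. -/
theorem exists_atMostOne (N : ℕ+) : ∀ w : Word, (∀ a ∈ w, a ≤ N) →
    ∃ u : Word, (∀ a ∈ u, a < N) ∧ (Interchangeable w u ∨
      ∃ u' : Word, (∀ a ∈ u', a < N) ∧ Interchangeable w (u ++ N :: u')) := by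
  intro w
  induction w with
  | nil => exact fun _ => ⟨[], by simp, Or.inl (Interchangeable.refl _)⟩
  | cons a w ih =>
    intro h
    obtain ⟨u, hu, hw⟩ := ih (fun b hb => h b (List.mem_cons_of_mem _ hb))
    rcases (h a (by simp)).eq_or_lt with rfl | ha
    · rcases hw with hw | ⟨u', hu', hw⟩
      · exact ⟨[], by simp, Or.inr ⟨u, hu, hw.cons a⟩⟩
      · obtain ⟨x, x', h1, h2, h3⟩ := exists_merge a _ u rfl hu
        refine ⟨x, h1, Or.inr ⟨x' ++ u', ?_, (hw.cons a).trans ?_⟩⟩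
        · intro b hb
          rcases List.mem_append.1 hb with hb | hb
          · exact h2 b hb
          · exact hu' b hb
        · simpa using h3.append_right u'
    · have hau : ∀ b ∈ a :: u, b < N := by
        intro b hb
        rcases List.mem_cons.1 hb with rfl | hb
        · exact ha
        · exact hu b hb
      rcases hw with hw | ⟨u', hu', hw⟩
      · exact ⟨a :: u, hau, Or.inl (hw.cons a)⟩
      · exact ⟨a :: u, hau, Or.inr ⟨u', hu', by simpa using hw.cons a⟩⟩

/-- There are finitely many weak K-Knuth classes of words with letters at most `N`. -/
theorem exists_finite_representatives (N : ℕ) : ∃ T : Set Word, T.Finite ∧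
    ∀ w : Word, (∀ a ∈ w, (a : ℕ) ≤ N) → ∃ t ∈ T, Interchangeable w t := by
  induction N with
  | zero =>
    refine ⟨{[]}, Set.finite_singleton _, fun w hw => ⟨[], rfl, ?_⟩⟩
    rcases w with _ | ⟨a, w⟩
    · exact Interchangeable.refl _
    · have := hw a (by simp)
      have := a.pos
      omega
  | succ N ih =>
    obtain ⟨T, hT, hw⟩ := ih
    -- The top letter `N + 1` is needed at most once, and the factors around it use smaller letters.
    refine ⟨T ∪ Set.image2 (fun u u' => u ++ N.succPNat :: u') T T,
      hT.union (hT.image2 _ hT), fun w hN => ?_⟩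
    have lower : ∀ {u : Word}, (∀ a ∈ u, a < N.succPNat) → ∀ a ∈ u, (a : ℕ) ≤ N := by
      intro u hu a ha
      exact Nat.lt_succ_iff.1 (PNat.coe_lt_coe _ _ |>.2 (hu a ha))
    obtain ⟨u, hu, h⟩ := exists_atMostOne N.succPNat w
      (fun a ha => PNat.coe_le_coe _ _ |>.1 (hN a ha))
    obtain ⟨t, ht, hut⟩ := hw u (lower hu)
    rcases h with h | ⟨u', hu', h⟩
    · exact ⟨t, Or.inl ht, h.trans hut⟩
    · obtain ⟨t', ht', hut'⟩ := hw u' (lower hu')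
      exact ⟨_, Or.inr ⟨t, ht, t', ht', rfl⟩, h.trans (hut.append (hut'.cons _))⟩

end Word

/-! ### Restriction to an interval of letters -/

namespace Word

/-- A partial relabelling of letters that is strictly increasing on its domain, an interval. -/
structure IsRelabelling (g : ℕ+ → Option ℕ+) : Prop where
  isSome_of_between : ∀ {a b c}, a < b → b < c → (g a).isSome → (g c).isSome → (g b).isSome
  strictMono : ∀ {a b x y}, a < b → g a = some x → g b = some y → x < y

theorem WeakKKnuth.of_step {u v : Word} (h : WeakKKnuthStep u v) : WeakKKnuth u v :=
  Relation.EqvGen.rel _ _ h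

/-- A move that loses a letter becomes an equality, except that `braid` losing one of its two
letters becomes `idem`. Losing only the middle letter of `bac` or `acb` would leave `ac ∼ ca` inside
a word; the interval condition excludes this. -/
theorem WeakKKnuth.filterMap {g : ℕ+ → Option ℕ+} (hg : IsRelabelling g) {u v : Word}
    (h : WeakKKnuth u v) : WeakKKnuth (u.filterMap g) (v.filterMap g) := by
  induction h with
  | refl => exact WeakKKnuth.refl _
  | symm _ _ _ ih => exact ih.symm
  | trans _ _ _ _ _ ih ih' => exact ih.trans ih'
  | rel u v h =>
    cases h with
    | idem u v a =>
      rcases ha : g a with _ | x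
      · simpa [ha] using WeakKKnuth.refl _
      · simpa [ha] using WeakKKnuth.of_step
          (WeakKKnuthStep.idem (u.filterMap g) (v.filterMap g) x)
    | braid u v a b hab =>
      rcases ha : g a with _ | x <;> rcases hb : g b with _ | y
      · simpa [ha, hb] using WeakKKnuth.refl _
      · simpa [ha, hb] using (WeakKKnuth.of_step
          (WeakKKnuthStep.idem (u.filterMap g) (v.filterMap g) y)).symm
      · simpa [ha, hb] using WeakKKnuth.of_step
          (WeakKKnuthStep.idem (u.filterMap g) (v.filterMap g) x)
      · simpa [ha, hb] using WeakKKnuth.of_step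
          (WeakKKnuthStep.braid (u.filterMap g) (v.filterMap g) x y (hg.strictMono hab ha hb))
    | bac u v a b c hab hbc =>
      rcases ha : g a with _ | x
      · simpa [ha, List.filterMap_cons] using WeakKKnuth.refl _
      rcases hc : g c with _ | z
      · simpa [hc, List.filterMap_cons] using WeakKKnuth.refl _
      obtain ⟨y, hb⟩ := Option.isSome_iff_exists.1
        (hg.isSome_of_between hab hbc (by simp [ha]) (by simp [hc]))
      simpa [ha, hb, hc] using WeakKKnuth.of_step
          (WeakKKnuthStep.bac (u.filterMap g) (v.filterMap g) x y z
            (hg.strictMono hab ha hb) (hg.strictMono hbc hb hc))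
    | acb u v a b c hab hbc =>
      rcases ha : g a with _ | x
      · simpa [ha, List.filterMap_cons] using WeakKKnuth.refl _
      rcases hc : g c with _ | z
      · simpa [hc, List.filterMap_cons] using WeakKKnuth.refl _
      obtain ⟨y, hb⟩ := Option.isSome_iff_exists.1
        (hg.isSome_of_between hab hbc (by simp [ha]) (by simp [hc]))
      simpa [ha, hb, hc] using WeakKKnuth.of_step
          (WeakKKnuthStep.acb (u.filterMap g) (v.filterMap g) x y z
            (hg.strictMono hab ha hb) (hg.strictMono hbc hb hc))
    | swap u a b hab =>
      rcases ha : g a with _ | x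
      · simpa [ha, List.filterMap_cons] using WeakKKnuth.refl _
      rcases hb : g b with _ | y
      · simpa [hb, List.filterMap_cons] using WeakKKnuth.refl _
      simpa [ha, hb] using WeakKKnuth.of_step
          (WeakKKnuthStep.swap (u.filterMap g) x y (hg.strictMono hab ha hb))

theorem WeakKKnuth.mem_iff {u v : Word} (h : WeakKKnuth u v) (a : ℕ+) : a ∈ u ↔ a ∈ v := by
  induction h with
  | refl => rfl
  | symm _ _ _ ih => exact ih.symm
  | trans _ _ _ _ _ ih ih' => exact ih.trans ih'
  | rel u v h => cases h <;> simp <;> tauto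

/-- Makes the shift in the product the same for all words of a class. -/
theorem WeakKKnuth.maxLetter_eq {u v : Word} (h : WeakKKnuth u v) :
    maxLetter u = maxLetter v :=
  eq_of_forall_ge_iff fun n => by simp only [maxLetter_le_iff, h.mem_iff]

/-- Keep a letter if it is at most `n`. -/
def lowLetter (n : ℕ) (a : ℕ+) : Option ℕ+ := if (a : ℕ) ≤ n then some a else none

/-- Subtract `n` from a letter larger than `n` and discard the other letters. -/
def highLetter (n : ℕ) (a : ℕ+) : Option ℕ+ :=
  if h : n < (a : ℕ) then some (Nat.toPNat ((a : ℕ) - n) (Nat.sub_pos_of_lt h)) else none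

theorem lowLetter_eq_some {n : ℕ} {a b : ℕ+} :
    lowLetter n a = some b ↔ (b : ℕ) ≤ n ∧ a = b := by
  unfold lowLetter
  split_ifs with h
  · simp only [Option.some.injEq]
    exact ⟨fun e => e ▸ ⟨h, rfl⟩, fun e => e.2⟩
  · simp only [false_iff]
    rintro ⟨h', rfl⟩
    exact h h'

theorem highLetter_eq_some {n : ℕ} {a b : ℕ+} :
    highLetter n a = some b ↔ a = shiftLetter n b := by
  unfold highLetter
  have hb := b.pos
  split_ifs with h
  · rw [Option.some.injEq, ← PNat.coe_inj, ← PNat.coe_inj, coe_shiftLetter]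
    change (a : ℕ) - n = b ↔ _
    omega
  · simp only [false_iff, ← PNat.coe_inj, coe_shiftLetter]
    omega

theorem highLetter_shiftLetter (n : ℕ) (a : ℕ+) : highLetter n (shiftLetter n a) = some a :=
  highLetter_eq_some.2 rfl

theorem lowLetter_shiftLetter (n : ℕ) (a : ℕ+) : lowLetter n (shiftLetter n a) = none := by
  have := a.pos
  simp [lowLetter, coe_shiftLetter]

theorem lowLetter_of_le {n : ℕ} {a : ℕ+} (h : (a : ℕ) ≤ n) : lowLetter n a = some a := by
  simp [lowLetter, h]

theorem highLetter_of_le {n : ℕ} {a : ℕ+} (h : (a : ℕ) ≤ n) : highLetter n a = none := by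
  simp [highLetter, h]

theorem exists_shiftLetter {n : ℕ} {a : ℕ+} (h : n < a) : ∃ b, a = shiftLetter n b :=
  ⟨⟨a - n, Nat.sub_pos_of_lt h⟩, PNat.eq (Nat.sub_add_cancel h.le).symm⟩

theorem isRelabelling_lowLetter (n : ℕ) : IsRelabelling (lowLetter n) where
  isSome_of_between := by
    intro a b c hab hbc ha hc
    rw [Option.isSome_iff_exists] at *
    obtain ⟨x, hx⟩ := hc
    obtain ⟨h, rfl⟩ := lowLetter_eq_some.1 hx
    exact ⟨b, lowLetter_eq_some.2 ⟨(PNat.coe_lt_coe _ _ |>.2 hbc).le.trans h, rfl⟩⟩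
  strictMono := by
    intro a b x y hab hx hy
    rw [← (lowLetter_eq_some.1 hx).2, ← (lowLetter_eq_some.1 hy).2]
    exact hab

theorem isRelabelling_highLetter (n : ℕ) : IsRelabelling (highLetter n) where
  isSome_of_between := by
    intro a b c hab hbc ha hc
    rw [Option.isSome_iff_exists] at *
    obtain ⟨x, hx⟩ := ha
    have hx := highLetter_eq_some.1 hx
    subst hx
    have := PNat.coe_lt_coe _ _ |>.2 hab
    rw [coe_shiftLetter] at this
    obtain ⟨y, rfl⟩ := exists_shiftLetter (show n < b by omega)
    exact ⟨y, highLetter_shiftLetter n y⟩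
  strictMono := by
    intro a b x y hab hx hy
    rw [highLetter_eq_some.1 hx, highLetter_eq_some.1 hy, ← PNat.coe_lt_coe] at hab
    simp only [coe_shiftLetter] at hab
    exact PNat.coe_lt_coe _ _ |>.1 (by omega)

/-- The subword of the letters that are at most `n`. -/
def lowPart (n : ℕ) (w : Word) : Word := w.filterMap (lowLetter n)

/-- The subword of the letters larger than `n`, decreased by `n`. -/
def highPart (n : ℕ) (w : Word) : Word := w.filterMap (highLetter n)

theorem mem_lowPart {n : ℕ} {w : Word} {a : ℕ+} : a ∈ lowPart n w ↔ a ∈ w ∧ (a : ℕ) ≤ n := by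
  simp only [lowPart, List.mem_filterMap, lowLetter_eq_some]
  exact ⟨fun ⟨b, hb, h, e⟩ => e ▸ ⟨hb, e ▸ h⟩, fun ⟨h, h'⟩ => ⟨a, h, h', rfl⟩⟩

theorem mem_highPart {n : ℕ} {w : Word} {a : ℕ+} : a ∈ highPart n w ↔ shiftLetter n a ∈ w := by
  simp only [highPart, List.mem_filterMap, highLetter_eq_some]
  exact ⟨fun ⟨b, hb, e⟩ => e ▸ hb, fun h => ⟨_, h, rfl⟩⟩

theorem lowPart_of_le {n : ℕ} {w : Word} (h : ∀ a ∈ w, (a : ℕ) ≤ n) : lowPart n w = w := by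
  induction w with
  | nil => rfl
  | cons a w ih =>
    have ha := h a (by simp)
    have := ih fun b hb => h b (List.mem_cons_of_mem _ hb)
    simp only [lowPart] at this ⊢
    simp [lowLetter_of_le ha, this]

theorem highPart_of_le {n : ℕ} {w : Word} (h : ∀ a ∈ w, (a : ℕ) ≤ n) : highPart n w = [] := by
  simp only [highPart, List.filterMap_eq_nil_iff]
  exact fun a ha => highLetter_of_le (h a ha)

theorem lowPart_shift (n : ℕ) (w : Word) : lowPart n (shift n w) = [] := by
  simp [lowPart, shift, lowLetter_shiftLetter]

theorem highPart_shift (n : ℕ) (w : Word) : highPart n (shift n w) = w := by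
  simp [highPart, shift, List.filterMap_map, highLetter_shiftLetter]

theorem eq_of_lowPart_eq_nil {n : ℕ} {u : Word} (h : lowPart n u = []) :
    u = shift n (highPart n u) := by
  induction u with
  | nil => rfl
  | cons a u ih =>
    by_cases ha : (a : ℕ) ≤ n
    · simp [lowPart, lowLetter_of_le ha] at h
    · obtain ⟨b, rfl⟩ := exists_shiftLetter (not_le.1 ha)
      have : lowPart n u = [] := by
        simpa [lowPart, lowLetter_shiftLetter] using h
      have := ih this
      conv_lhs => rw [this]
      simp [highPart, highLetter_shiftLetter, shift]

theorem eq_of_highPart_eq_nil {n : ℕ} {u : Word} (h : highPart n u = []) :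
    u = lowPart n u := by
  refine (lowPart_of_le fun a ha => ?_).symm
  by_contra hn
  obtain ⟨b, rfl⟩ := exists_shiftLetter (not_le.1 hn)
  have := mem_highPart.2 ha
  simp [h] at this

/-- A word occurs at most once in the shuffle of two words whose letters are separated by `n`. -/
theorem count_shuffle_shift (n : ℕ) : ∀ w v u : Word, (∀ a ∈ w, (a : ℕ) ≤ n) →
    (shuffle w (shift n v)).count u = if w = lowPart n u ∧ v = highPart n u then 1 else 0
  | [], v, u, _ => by
    rw [shuffle_nil_left, Multiset.count_singleton]
    refine if_congr ⟨?_, ?_⟩ rfl rfl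
    · rintro rfl
      rw [lowPart_shift, highPart_shift]
      exact ⟨rfl, rfl⟩
    · rintro ⟨h, rfl⟩
      exact eq_of_lowPart_eq_nil h.symm
  | a :: w, [], u, hw => by
    simp only [shift, List.map_nil]
    rw [shuffle_nil_right, Multiset.count_singleton]
    refine if_congr ⟨?_, ?_⟩ rfl rfl
    · rintro rfl
      exact ⟨(lowPart_of_le hw).symm, (highPart_of_le hw).symm⟩
    · rintro ⟨h, h'⟩
      rw [h]
      exact eq_of_highPart_eq_nil h'.symm
  | a :: w, b :: v, [], hw => by
    simp only [shift, List.map_cons]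
    rw [shuffle_cons_cons, Multiset.count_add]
    simp [lowPart]
  | a :: w, b :: v, c :: u, hw => by
    have h1 := count_shuffle_shift n w (b :: v) u fun a ha => hw a (List.mem_cons_of_mem _ ha)
    have h2 := count_shuffle_shift n (a :: w) v u hw
    simp only [shift, List.map_cons] at h1 h2 ⊢
    rw [shuffle_cons_cons, Multiset.count_add]
    have cons_count : ∀ (d : ℕ+) (m : Multiset Word),
        (m.map (List.cons d)).count (c :: u) = if d = c then m.count u else 0 := by
      intro d m
      split_ifs with h
      · subst h
        exact Multiset.count_map_eq_count' _ _ List.cons_injective _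
      · rw [Multiset.count_eq_zero, Multiset.mem_map]
        rintro ⟨x, -, hx⟩
        exact h (List.cons.inj hx).1
    rw [cons_count, cons_count, h1, h2]
    have ha := hw a (by simp)
    -- Only one summand of the shuffle can begin with `c`: the first if `c ≤ n`, the second
    -- otherwise.
    by_cases hc : (c : ℕ) ≤ n
    · have hbc : shiftLetter n b ≠ c := by
        rintro rfl
        have := b.pos
        rw [coe_shiftLetter] at hc
        omega
      have e1 : lowPart n (c :: u) = c :: lowPart n u := by simp [lowPart, lowLetter_of_le hc]
      have e2 : highPart n (c :: u) = highPart n u := by simp [highPart, highLetter_of_le hc]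
      rw [e1, e2, if_neg hbc]
      by_cases hac : a = c <;> simp [hac]
    · obtain ⟨d, rfl⟩ := exists_shiftLetter (not_le.1 hc)
      have hac : a ≠ shiftLetter n d := by
        rintro rfl
        exact hc ha
      have e1 : lowPart n (shiftLetter n d :: u) = lowPart n u := by
        simp [lowPart, lowLetter_shiftLetter]
      have e2 : highPart n (shiftLetter n d :: u) = d :: highPart n u := by
        simp [highPart, highLetter_shiftLetter]
      rw [e1, e2, if_neg hac]
      by_cases hbd : b = d <;> simp [hbd, (shiftLetter_injective n).eq_iff]
termination_by w v => w.length + v.length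

end Word

/-! ### Products of classes and closure of `SKPR` -/

namespace WordSeries

open Word

open Classical in
/-- The formal sum of the words in a set. -/
noncomputable def indicator (S : Set Word) : WordSeries := fun w => if w ∈ S then 1 else 0

theorem wordClass_eq_indicator (h : Word) : wordClass h = indicator {w | WeakKKnuth h w} := rfl

theorem indicator_of_mem {S : Set Word} {w : Word} (h : w ∈ S) : indicator S w = 1 :=
  if_pos h

theorem indicator_of_notMem {S : Set Word} {w : Word} (h : w ∉ S) : indicator S w = 0 :=
  if_neg h

/-- The words that occur in the product of the classes of `h` and `h'`. -/
def productSet (h h' : Word) : Set Word :=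
  {u | WeakKKnuth h (lowPart (maxLetter h) u) ∧ WeakKKnuth h' (highPart (maxLetter h) u)}

/-- For fixed `u` at most one pair contributes, namely its two restrictions, and it does so with
multiplicity one. -/
theorem wordClass_mul_wordClass (h h' : Word) :
    wordClass h * wordClass h' = indicator (productSet h h') := by
  ext u
  rw [mul_apply]
  set n := maxLetter h with hn
  have key : ∀ p : Word × Word,
      wordClass h p.1 * wordClass h' p.2 * (shuffleCoeff p.1 p.2 u : ℝ) =
        if p = (lowPart n u, highPart n u) then indicator (productSet h h') u else 0 := by
    rintro ⟨w, v⟩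
    by_cases hw : WeakKKnuth h w
    · have hl : ∀ a ∈ w, (a : ℕ) ≤ n := by
        rw [← maxLetter_le_iff, hn, hw.maxLetter_eq]
      have hc : shuffleCoeff w v u = if w = lowPart n u ∧ v = highPart n u then 1 else 0 := by
        rw [shuffleCoeff, ← hw.maxLetter_eq, ← hn, count_shuffle_shift n w v u hl]
      rw [hc]
      by_cases he : w = lowPart n u ∧ v = highPart n u
      · obtain ⟨rfl, rfl⟩ := he
        by_cases hv : WeakKKnuth h' (highPart n u)
        · rw [indicator_of_mem (S := productSet h h') ⟨hw, hv⟩]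
          simp [wordClass, hw, hv]
        · rw [indicator_of_notMem (S := productSet h h') fun h => hv h.2]
          simp [wordClass, hv]
      · simp [he]
    · have h0 : wordClass h w = 0 := if_neg hw
      rw [h0]
      split_ifs with he
      · obtain ⟨rfl, rfl⟩ := Prod.mk.inj he
        rw [indicator_of_notMem (S := productSet h h') fun h => hw h.1]
        simp
      · simp
  rw [finsum_congr key, finsum_eq_single _ (lowPart n u, highPart n u)]
  · simp
  · intro p hp
    simp [hp]

/-- Both restrictions respect the equivalence, so the product is a sum of whole classes. -/
theorem mem_productSet_of_weakKKnuth {h h' u v : Word} (hu : u ∈ productSet h h')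
    (huv : WeakKKnuth u v) : v ∈ productSet h h' :=
  ⟨hu.1.trans (huv.filterMap (isRelabelling_lowLetter _)),
    hu.2.trans (huv.filterMap (isRelabelling_highLetter _))⟩

theorem maxLetter_of_initial {h : Word} {k : ℕ+} (hk : ∀ a : ℕ+, a ∈ h ↔ a ≤ k) :
    maxLetter h = k := by
  refine eq_of_forall_ge_iff fun n => ?_
  rw [maxLetter_le_iff]
  exact ⟨fun H => H k ((hk k).2 le_rfl),
    fun H a ha => le_trans (PNat.coe_le_coe _ _ |>.2 ((hk a).1 ha)) H⟩

/-- The low restriction supplies the letters up to `k`, the high one the next `k'` letters; the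
words of the product are thus initial and bounded. -/
theorem mem_iff_of_mem_productSet {h h' u : Word} {k k' : ℕ+} (hk : ∀ a : ℕ+, a ∈ h ↔ a ≤ k)
    (hk' : ∀ a : ℕ+, a ∈ h' ↔ a ≤ k') (hu : u ∈ productSet h h') (a : ℕ+) :
    a ∈ u ↔ a ≤ k + k' := by
  have hm := maxLetter_of_initial hk
  obtain ⟨h1, h2⟩ := hu
  rw [hm] at h1 h2
  by_cases ha : (a : ℕ) ≤ k
  · have h3 := (h1.mem_iff a).symm.trans (hk a)
    rw [mem_lowPart] at h3
    have h4 : a ≤ k := PNat.coe_le_coe _ _ |>.1 ha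
    have h5 : a ≤ k + k' := h4.trans (PNat.lt_add_right k k').le
    simp only [ha, and_true] at h3
    simp [h3, h4, h5]
  · obtain ⟨b, rfl⟩ := exists_shiftLetter (not_le.1 ha)
    have h3 := (h2.mem_iff b).symm.trans (hk' b)
    rw [mem_highPart] at h3
    rw [h3, ← PNat.coe_le_coe, ← PNat.coe_le_coe, coe_shiftLetter, PNat.add_coe]
    omega

theorem wordClass_eq_of_weakKKnuth {u v : Word} (h : WeakKKnuth u v) :
    wordClass u = wordClass v := by
  ext w
  by_cases hw : WeakKKnuth u w
  · exact (if_pos hw).trans (if_pos (h.symm.trans hw)).symm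
  · exact (if_neg hw).trans (if_neg fun h' => hw (h.trans h')).symm

/-- The formal sum of a union of classes of initial words with bounded letters lies in `SKPR`. -/
theorem indicator_mem_SKPR {S : Set Word} (hS : ∀ u ∈ S, IsInitial u)
    (hclosed : ∀ u ∈ S, ∀ v, WeakKKnuth u v → v ∈ S) {N : ℕ}
    (hN : ∀ u ∈ S, ∀ a ∈ u, (a : ℕ) ≤ N) : indicator S ∈ SKPR := by
  obtain ⟨T, hT, hrep⟩ := exists_finite_representatives N
  -- Each word of `S` is equivalent to one of the finitely many representatives, so `S` is a finite
  -- union of classes.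
  have hfin : (wordClass '' S).Finite := by
    refine (hT.image wordClass).subset ?_
    rintro _ ⟨u, hu, rfl⟩
    obtain ⟨t, ht, h⟩ := hrep u (hN u hu)
    exact ⟨t, ht, (wordClass_eq_of_weakKKnuth h.weakKKnuth).symm⟩
  have hsum : indicator S = ∑ F ∈ hfin.toFinset, F := by
    have happly : ∀ (Q : Finset WordSeries) (u : Word), (∑ F ∈ Q, F) u = ∑ F ∈ Q, F u :=
      fun Q u => Finset.sum_apply u Q fun F : Word → ℝ => F
    ext u
    rw [happly]
    by_cases hu : u ∈ S
    · rw [indicator_of_mem hu, Finset.sum_eq_single (wordClass u)]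
      · exact (if_pos (WeakKKnuth.refl u)).symm
      · intro F hF hne
        obtain ⟨v, hv, rfl⟩ := hfin.mem_toFinset.1 hF
        exact if_neg fun h => hne (wordClass_eq_of_weakKKnuth h)
      · intro h
        exact absurd (hfin.mem_toFinset.2 ⟨u, hu, rfl⟩) h
    · rw [indicator_of_notMem hu]
      symm
      refine Finset.sum_eq_zero fun F hF => ?_
      obtain ⟨v, hv, rfl⟩ := hfin.mem_toFinset.1 hF
      exact if_neg fun h => hu (hclosed v hv u h)
  rw [hsum]
  refine Submodule.sum_mem _ fun F hF => ?_
  obtain ⟨v, hv, rfl⟩ := hfin.mem_toFinset.1 hF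
  exact Submodule.subset_span ⟨v, hS v hv, rfl⟩

theorem wordClass_mul_mem_SKPR {h h' : Word} (hh : IsInitial h) (hh' : IsInitial h') :
    wordClass h * wordClass h' ∈ SKPR := by
  obtain ⟨k, hk⟩ := hh
  obtain ⟨k', hk'⟩ := hh'
  rw [wordClass_mul_wordClass]
  refine indicator_mem_SKPR (N := k + k') (fun u hu => ⟨k + k', mem_iff_of_mem_productSet hk hk' hu⟩)
    (fun u hu v huv => mem_productSet_of_weakKKnuth hu huv) (fun u hu a ha => ?_)
  have := (mem_iff_of_mem_productSet hk hk' hu a).1 ha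
  rwa [← PNat.coe_le_coe] at this

theorem mul_mem_SKPR {F G : WordSeries} (hF : F ∈ SKPR) (hG : G ∈ SKPR) : F * G ∈ SKPR := by
  refine Submodule.span_induction₂ (p := fun F G _ _ => F * G ∈ SKPR) ?_ ?_ ?_ ?_ ?_ ?_ ?_ hF hG
  · rintro _ _ ⟨h, hh, rfl⟩ ⟨h', hh', rfl⟩
    exact wordClass_mul_mem_SKPR hh hh'
  · intro G _
    rw [zero_mul]
    exact zero_mem _
  · intro F _
    rw [mul_zero]
    exact zero_mem _
  · intro F F' G _ _ _ h1 h2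
    rw [add_mul]
    exact add_mem h1 h2
  · intro F G G' _ _ _ h1 h2
    rw [mul_add]
    exact add_mem h1 h2
  · intro r F G _ _ h
    rw [smul_mul_assoc]
    exact Submodule.smul_mem _ r h
  · intro r F G _ _ h
    rw [mul_smul_comm]
    exact Submodule.smul_mem _ r h

end WordSeries

/-! ### Multisets of pairs and coefficients of fundamental quasisymmetric functions -/

/-- The multiset of upper entries of a multiset of pairs. -/
def topRow (P : Multiset (ℕ+ ×ₗ ℕ+)) : Multiset ℕ+ := P.map fun x => (ofLex x).1

/-- The word of lower entries of a multiset of pairs, read in lexicographic order. -/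
def bottomRow (P : Multiset (ℕ+ ×ₗ ℕ+)) : Word := (P.sort (· ≤ ·)).map fun x => (ofLex x).2

theorem sort_coe_of_pairwise {α : Type*} [LinearOrder α] {l : List α}
    (h : l.Pairwise (· ≤ ·)) : (l : Multiset α).sort (· ≤ ·) = l := by
  rw [Multiset.coe_sort]
  exact List.mergeSort_eq_self (· ≤ ·) h

theorem topRow_add (P Q : Multiset (ℕ+ ×ₗ ℕ+)) : topRow (P + Q) = topRow P + topRow Q :=
  Multiset.map_add _ _ _

theorem length_bottomRow (P : Multiset (ℕ+ ×ₗ ℕ+)) : (bottomRow P).length = P.card := by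
  simp [bottomRow]

theorem pairwise_map_fst_sort (P : Multiset (ℕ+ ×ₗ ℕ+)) :
    ((P.sort (· ≤ ·)).map fun x => (ofLex x).1).Pairwise (· ≤ ·) := by
  rw [List.pairwise_map]
  refine (P.pairwise_sort (· ≤ ·)).imp fun {x y} h => ?_
  rcases Prod.Lex.le_iff.1 h with h | h
  · exact h.le
  · exact h.1.le

theorem coe_map_fst_sort (P : Multiset (ℕ+ ×ₗ ℕ+)) :
    (((P.sort (· ≤ ·)).map fun x => (ofLex x).1 : List ℕ+) : Multiset ℕ+) = topRow P := by
  rw [← Multiset.map_coe, Multiset.sort_eq, topRow]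

/-- A multiset of pairs is determined by its two rows. -/
theorem eq_of_topRow_eq_of_bottomRow_eq {P Q : Multiset (ℕ+ ×ₗ ℕ+)}
    (h : topRow P = topRow Q) (h' : bottomRow P = bottomRow Q) : P = Q := by
  -- Upper entries weakly increase in lexicographic order, so this column is the sorted upper row.
  have h1 : (P.sort (· ≤ ·)).map (fun x => (ofLex x).1) =
      (Q.sort (· ≤ ·)).map (fun x => (ofLex x).1) := by
    rw [← sort_coe_of_pairwise (pairwise_map_fst_sort P), coe_map_fst_sort, h,
      ← coe_map_fst_sort, sort_coe_of_pairwise (pairwise_map_fst_sort Q)]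
  have h2 : P.sort (· ≤ ·) = Q.sort (· ≤ ·) := by
    refine List.ext_getElem (by simpa using congrArg List.length h1) fun i hi hi' => ?_
    have e1 := List.getElem_of_eq h1 (i := i) (by simpa using hi)
    have e2 := List.getElem_of_eq h' (i := i) (by simpa [bottomRow] using hi)
    simp only [bottomRow, List.getElem_map] at e1 e2
    exact ofLex.injective (Prod.ext e1 e2)
  rw [← Multiset.sort_eq P (· ≤ ·), h2, Multiset.sort_eq]

theorem sum_single_eq_toFinsupp {n : ℕ} (s : Fin n → ℕ+) :
    ∑ t, Finsupp.single (s t) 1 = Multiset.toFinsupp (List.ofFn s : Multiset ℕ+) := by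
  induction n with
  | zero => simp
  | succ n ih =>
    rw [Fin.sum_univ_succ, ih, List.ofFn_succ, ← Multiset.cons_coe, ← Multiset.singleton_add,
      map_add, Multiset.toFinsupp_singleton]

open Classical in
/-- The coefficient of a monomial in `f_{D(w)}` is one if the monomial is the upper row of a
multiset of pairs with lower row `w`, and zero otherwise. -/
theorem coeff_fundamentalOfWord (w : Word) (m : ℕ+ →₀ ℕ) :
    MvPowerSeries.coeff m (fundamentalOfWord w) =
      if ∃ P, topRow P = Finsupp.toMultiset m ∧ bottomRow P = w then 1 else 0 := by
  set A : Set (Fin w.length → ℕ+) := {s | Monotone s ∧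
    (∀ (j : ℕ) (hj : j + 1 < w.length), j ∈ Word.descentSet w →
      s ⟨j, by omega⟩ < s ⟨j + 1, hj⟩) ∧ ∑ t, Finsupp.single (s t) 1 = m} with hA
  have hcoeff : MvPowerSeries.coeff m (fundamentalOfWord w) = (A.ncard : ℝ) := rfl
  have content : ∀ s : Fin w.length → ℕ+, ∑ t, Finsupp.single (s t) 1 = m ↔
      (List.ofFn s : Multiset ℕ+) = Finsupp.toMultiset m := by
    intro s
    rw [sum_single_eq_toFinsupp]
    exact ⟨fun h => by rw [← h, Multiset.toFinsupp_toMultiset],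
      fun h => by rw [h, Finsupp.toMultiset_toFinsupp]⟩
  -- A weakly increasing sequence is the sorted list of its content.
  have hsub : A.Subsingleton := by
    rintro s ⟨hs, -, hc⟩ t ⟨ht, -, hc'⟩
    apply List.ofFn_injective
    rw [← sort_coe_of_pairwise (List.sortedLE_ofFn_iff.2 hs).pairwise, (content s).1 hc,
      ← (content t).1 hc', sort_coe_of_pairwise (List.sortedLE_ofFn_iff.2 ht).pairwise]
  -- For weakly increasing `s`, the pairs `(s t, w t)` are in lexicographic order exactly when `s`
  -- increases strictly at the descents of `w`.
  have hne : A.Nonempty ↔ ∃ P, topRow P = Finsupp.toMultiset m ∧ bottomRow P = w := by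
    constructor
    · rintro ⟨s, hs, hd, hc⟩
      set l : List (ℕ+ ×ₗ ℕ+) := List.ofFn fun t : Fin w.length => toLex (s t, w[t]) with hl
      have hsorted : l.Pairwise (· ≤ ·) := by
        rw [← List.isChain_iff_pairwise, List.isChain_iff_getElem]
        intro i hi
        have hi' : i + 1 < w.length := by simpa [hl] using hi
        simp only [hl, List.getElem_ofFn, Prod.Lex.le_iff, ofLex_toLex]
        have hm : s ⟨i, by omega⟩ ≤ s ⟨i + 1, hi'⟩ := hs (by simp)
        rcases hm.lt_or_eq with h | h
        · exact Or.inl h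
        · refine Or.inr ⟨h, not_lt.1 fun h' => ?_⟩
          exact (hd i hi' ⟨hi', h'⟩).ne h
      refine ⟨l, ?_, ?_⟩
      · rw [topRow, Multiset.map_coe, hl, List.map_ofFn]
        exact (content s).1 hc
      · rw [bottomRow, sort_coe_of_pairwise hsorted, hl, List.map_ofFn]
        exact List.ofFn_getElem
    · rintro ⟨P, hP, rfl⟩
      have hlen : ∀ {i}, i < (bottomRow P).length → i < (P.sort (· ≤ ·)).length := by
        intro i hi
        simpa [length_bottomRow] using hi
      have hle : ∀ {i j : ℕ} (hi : i < (P.sort (· ≤ ·)).length)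
          (hj : j < (P.sort (· ≤ ·)).length), i ≤ j →
          (P.sort (· ≤ ·))[i] ≤ (P.sort (· ≤ ·))[j] := by
        intro i j hi hj hij
        rcases hij.eq_or_lt with rfl | hij
        · exact le_rfl
        · exact List.pairwise_iff_getElem.1 (P.pairwise_sort (· ≤ ·)) i j hi hj hij
      refine ⟨fun t => (ofLex ((P.sort (· ≤ ·))[(t : ℕ)]'(hlen t.2))).1, ?_, ?_, ?_⟩
      · intro i j hij
        rcases Prod.Lex.le_iff.1 (hle (hlen i.2) (hlen j.2) hij) with h | h
        · exact h.le
        · exact h.1.le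
      · rintro j hj ⟨_, hd⟩
        rcases Prod.Lex.le_iff.1 (hle (hlen (j.lt_succ_self.trans hj)) (hlen hj) j.le_succ)
          with h | h
        · exact h
        · simp only [bottomRow, List.getElem_map] at hd
          exact absurd h.2 (not_le.2 hd)
      · rw [content, ← hP, ← coe_map_fst_sort]
        congr 1
        refine List.ext_getElem (by simp [length_bottomRow]) fun i hi hi' => ?_
        simp
  rw [hcoeff]
  split_ifs with h
  · obtain ⟨s, hs⟩ := hne.2 h
    rw [hsub.eq_singleton_of_mem hs, Set.ncard_singleton, Nat.cast_one]
  · rw [Set.not_nonempty_iff_eq_empty.1 (hne.not.2 h), Set.ncard_empty, Nat.cast_zero]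

/-- Sequences whose content lies in the range of `i` pull back along `i` to sequences in `Fin k`
with the same order conditions, so their number does not depend on `i`. -/
theorem isQuasisymmetric_fundamental (n : ℕ) (D : Set ℕ) :
    IsQuasisymmetric (fundamental n D) := by
  have key : ∀ (k : ℕ) (i : Fin k ↪o ℕ+) (a : Fin k →₀ ℕ),
      MvPowerSeries.coeff (a.embDomain i.toEmbedding) (fundamental n D) =
        (Set.ncard {t : Fin n → Fin k | Monotone t ∧
          (∀ (j : ℕ) (hj : j + 1 < n), j ∈ D → t ⟨j, by omega⟩ < t ⟨j + 1, hj⟩) ∧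
          ∑ r, Finsupp.single (t r) 1 = a} : ℝ) := by
    intro k i a
    have hinj : Function.Injective fun t : Fin n → Fin k => (i ∘ t : Fin n → ℕ+) :=
      fun t t' h => funext fun r => i.injective (congrFun h r)
    rw [← Set.ncard_image_of_injective _ hinj]
    change ((Set.ncard _ : ℕ) : ℝ) = _
    congr 2
    have hsum : ∀ t : Fin n → Fin k, ∑ r, Finsupp.single (i (t r)) 1 =
        (∑ r, Finsupp.single (t r) 1 : Fin k →₀ ℕ).embDomain i.toEmbedding := by
      intro t
      simp only [Finsupp.embDomain_eq_mapDomain, Finsupp.mapDomain_finsetSum,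
        Finsupp.mapDomain_single]
      rfl
    ext s
    constructor
    · rintro ⟨hs, hd, hc⟩
      -- A value outside the range of `i` would be a variable absent from the monomial.
      have hr : ∀ r, ∃ x, i x = s r := by
        intro r
        by_contra hx
        have h0 := DFunLike.congr_fun hc (s r)
        rw [Finsupp.embDomain_of_notMem_range _ _ _ (by simpa using hx),
          Finsupp.finsetSum_apply] at h0
        have := Finset.sum_eq_zero_iff.1 h0 r (Finset.mem_univ r)
        simp at this
      choose t ht using hr
      have hst : s = i ∘ t := funext fun r => (ht r).symm
      subst hst
      refine ⟨t, ⟨?_, ?_, ?_⟩, rfl⟩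
      · exact fun x y hxy => i.le_iff_le.1 (hs hxy)
      · exact fun j hj hD => i.lt_iff_lt.1 (hd j hj hD)
      · exact Finsupp.embDomain_injective i.toEmbedding ((hsum t).symm.trans hc)
    · rintro ⟨t, ⟨ht, hd, rfl⟩, rfl⟩
      exact ⟨fun x y hxy => i.monotone (ht hxy), fun j hj hD => i.strictMono (hd j hj hD), hsum t⟩
  intro k i j a
  rw [key, key]

/-! ### Cutting a multiset of pairs at a lower entry -/

open Word WordSeries

/-- Relabel the lower entry of a pair. -/
def relabelPair (g : ℕ+ → Option ℕ+) (x : ℕ+ ×ₗ ℕ+) : Option (ℕ+ ×ₗ ℕ+) :=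
  (g (ofLex x).2).map fun b => toLex ((ofLex x).1, b)

/-- A relabelling is strictly increasing where defined, so it keeps the surviving pairs in
lexicographic order and commutes with sorting. -/
theorem bottomRow_filterMap {g : ℕ+ → Option ℕ+} (hg : IsRelabelling g)
    (P : Multiset (ℕ+ ×ₗ ℕ+)) :
    bottomRow (P.filterMap (relabelPair g)) = (bottomRow P).filterMap g := by
  have hsort : (P.filterMap (relabelPair g)).sort (· ≤ ·) =
      (P.sort (· ≤ ·)).filterMap (relabelPair g) := by
    conv_lhs => rw [← Multiset.sort_eq P (· ≤ ·), Multiset.filterMap_coe]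
    refine sort_coe_of_pairwise ((P.pairwise_sort (· ≤ ·)).filterMap _ ?_)
    intro x y hxy x' hx y' hy
    obtain ⟨a, ha, rfl⟩ := Option.map_eq_some_iff.1 hx
    obtain ⟨b, hb, rfl⟩ := Option.map_eq_some_iff.1 hy
    simp only [Prod.Lex.le_iff, ofLex_toLex] at hxy ⊢
    refine hxy.imp_right fun h => ⟨h.1, ?_⟩
    rcases h.2.lt_or_eq with h | h
    · exact (hg.strictMono h ha hb).le
    · rw [h, hb] at ha
      exact (Option.some.inj ha).ge
  rw [bottomRow, hsort, bottomRow, List.map_filterMap, List.filterMap_map]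
  congr 1
  funext x
  simp [relabelPair, Function.comp_def]

theorem mem_bottomRow {P : Multiset (ℕ+ ×ₗ ℕ+)} {a : ℕ+} :
    a ∈ bottomRow P ↔ ∃ x ∈ P, (ofLex x).2 = a := by
  simp [bottomRow]

/-- Increase the lower entry of a pair by `n`. -/
def shiftPair (n : ℕ) (x : ℕ+ ×ₗ ℕ+) : ℕ+ ×ₗ ℕ+ := toLex ((ofLex x).1, shiftLetter n (ofLex x).2)

theorem topRow_map_shiftPair (n : ℕ) (P : Multiset (ℕ+ ×ₗ ℕ+)) :
    topRow (P.map (shiftPair n)) = topRow P := by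
  simp [topRow, shiftPair, Multiset.map_map, Function.comp_def]

/-- The pairs with lower entry at most `n`. -/
def lowPairs (n : ℕ) (P : Multiset (ℕ+ ×ₗ ℕ+)) : Multiset (ℕ+ ×ₗ ℕ+) :=
  P.filterMap (relabelPair (lowLetter n))

/-- The pairs with lower entry larger than `n`, with that entry decreased by `n`. -/
def highPairs (n : ℕ) (P : Multiset (ℕ+ ×ₗ ℕ+)) : Multiset (ℕ+ ×ₗ ℕ+) :=
  P.filterMap (relabelPair (highLetter n))

theorem relabelPair_of_eq_some {g : ℕ+ → Option ℕ+} {x : ℕ+ ×ₗ ℕ+} {b : ℕ+}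
    (h : g (ofLex x).2 = some b) : relabelPair g x = some (toLex ((ofLex x).1, b)) := by
  simp [relabelPair, h]

theorem relabelPair_of_eq_none {g : ℕ+ → Option ℕ+} {x : ℕ+ ×ₗ ℕ+}
    (h : g (ofLex x).2 = none) : relabelPair g x = none := by
  simp [relabelPair, h]

/-- With `lowPairs_add_map_shiftPair` and `highPairs_add_map_shiftPair`, this makes cutting at `n`
inverse to the shifted union. -/
theorem lowPairs_add_highPairs (n : ℕ) (P : Multiset (ℕ+ ×ₗ ℕ+)) :
    lowPairs n P + (highPairs n P).map (shiftPair n) = P := by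
  induction P using Multiset.induction_on with
  | empty => simp [lowPairs, highPairs]
  | cons x P ih =>
    by_cases hx : ((ofLex x).2 : ℕ) ≤ n
    · rw [lowPairs, highPairs, Multiset.filterMap_cons_none _ _
          (relabelPair_of_eq_none (highLetter_of_le hx)),
        Multiset.filterMap_cons_some _ _ _ (relabelPair_of_eq_some (lowLetter_of_le hx)),
        Multiset.cons_add]
      exact congrArg _ ih
    · obtain ⟨b, hb⟩ := exists_shiftLetter (not_le.1 hx)
      have hh : highLetter n (ofLex x).2 = some b := highLetter_eq_some.2 hb
      have hl : lowLetter n (ofLex x).2 = none := hb ▸ lowLetter_shiftLetter n b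
      have hs : shiftPair n (toLex ((ofLex x).1, b)) = x := by
        simp only [shiftPair, ofLex_toLex, ← hb]
        rfl
      rw [lowPairs, highPairs, Multiset.filterMap_cons_none _ _ (relabelPair_of_eq_none hl),
        Multiset.filterMap_cons_some _ _ _ (relabelPair_of_eq_some hh),
        Multiset.map_cons, Multiset.add_cons, hs]
      exact congrArg _ ih

theorem lowPairs_map_shiftPair (n : ℕ) (P : Multiset (ℕ+ ×ₗ ℕ+)) :
    lowPairs n (P.map (shiftPair n)) = 0 := by
  induction P using Multiset.induction_on with
  | empty => rfl
  | cons x P ih =>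
    rw [Multiset.map_cons, lowPairs, Multiset.filterMap_cons_none _ _
      (relabelPair_of_eq_none (lowLetter_shiftLetter n _))]
    exact ih

theorem highPairs_map_shiftPair (n : ℕ) (P : Multiset (ℕ+ ×ₗ ℕ+)) :
    highPairs n (P.map (shiftPair n)) = P := by
  induction P using Multiset.induction_on with
  | empty => rfl
  | cons x P ih =>
    rw [Multiset.map_cons, highPairs, Multiset.filterMap_cons_some _ _ _
      (relabelPair_of_eq_some (highLetter_shiftLetter n _))]
    exact congrArg _ ih

theorem lowPairs_add_map_shiftPair {n : ℕ} {P : Multiset (ℕ+ ×ₗ ℕ+)}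
    (hP : ∀ x ∈ P, ((ofLex x).2 : ℕ) ≤ n) (Q : Multiset (ℕ+ ×ₗ ℕ+)) :
    lowPairs n (P + Q.map (shiftPair n)) = P := by
  induction P using Multiset.induction_on with
  | empty => rw [zero_add, lowPairs_map_shiftPair]
  | cons x P ih =>
    rw [Multiset.cons_add, lowPairs, Multiset.filterMap_cons_some _ _ _
      (relabelPair_of_eq_some (lowLetter_of_le (hP x (Multiset.mem_cons_self x P))))]
    exact congrArg _ (ih fun y hy => hP y (Multiset.mem_cons_of_mem hy))

theorem highPairs_add_map_shiftPair {n : ℕ} {P : Multiset (ℕ+ ×ₗ ℕ+)}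
    (hP : ∀ x ∈ P, ((ofLex x).2 : ℕ) ≤ n) (Q : Multiset (ℕ+ ×ₗ ℕ+)) :
    highPairs n (P + Q.map (shiftPair n)) = Q := by
  induction P using Multiset.induction_on with
  | empty => rw [zero_add, highPairs_map_shiftPair]
  | cons x P ih =>
    rw [Multiset.cons_add, highPairs, Multiset.filterMap_cons_none _ _
      (relabelPair_of_eq_none (highLetter_of_le (hP x (Multiset.mem_cons_self x P))))]
    exact ih fun y hy => hP y (Multiset.mem_cons_of_mem hy)

/-! ### Coefficients as counts, and their convolution -/

/-- The multisets of pairs with upper row `m` and lower row in `S`. -/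
def pairsOver (S : Set Word) (m : ℕ+ →₀ ℕ) : Set (Multiset (ℕ+ ×ₗ ℕ+)) :=
  {P | topRow P = Finsupp.toMultiset m ∧ bottomRow P ∈ S}

theorem bottomRow_injOn_pairsOver (S : Set Word) (m : ℕ+ →₀ ℕ) :
    Set.InjOn bottomRow (pairsOver S m) := fun _ hP _ hQ h =>
  eq_of_topRow_eq_of_bottomRow_eq (hP.1.trans hQ.1.symm) h

theorem length_bottomRow_of_topRow_eq {P : Multiset (ℕ+ ×ₗ ℕ+)} {m : ℕ+ →₀ ℕ}
    (h : topRow P = Finsupp.toMultiset m) :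
    (bottomRow P).length = (Finsupp.toMultiset m).card := by
  rw [length_bottomRow, ← h, topRow, Multiset.card_map]

/-- The upper row fixes the length of the lower row, `N` bounds its letters, and the lower row then
determines the multiset. -/
theorem pairsOver_finite {S : Set Word} {N : ℕ} (hS : ∀ w ∈ S, maxLetter w ≤ N)
    (m : ℕ+ →₀ ℕ) : (pairsOver S m).Finite := by
  refine Set.Finite.of_finite_image
    ((boundedWords_finite (Finsupp.toMultiset m).card N).subset ?_)
    (bottomRow_injOn_pairsOver S m)
  rintro _ ⟨P, hP, rfl⟩
  exact ⟨(length_bottomRow_of_topRow_eq hP.1).le, hS _ hP.2⟩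

theorem length_eq_of_coeff_ne_zero {w : Word} {m : ℕ+ →₀ ℕ}
    (h : MvPowerSeries.coeff m (fundamentalOfWord w) ≠ 0) :
    w.length = (Finsupp.toMultiset m).card := by
  rw [coeff_fundamentalOfWord] at h
  split_ifs at h with hP
  · obtain ⟨P, hP, rfl⟩ := hP
    exact length_bottomRow_of_topRow_eq hP
  · exact absurd rfl h

/-- The linear extension of `w ↦ f_{D(w)}` to formal sums of words. -/
noncomputable def fundamentalSum (F : WordSeries) : MvPowerSeries ℕ+ ℝ := fun m =>
  ∑ᶠ w : Word, F w * MvPowerSeries.coeff m (fundamentalOfWord w)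

theorem coeff_fundamentalSum (F : WordSeries) (m : ℕ+ →₀ ℕ) :
    MvPowerSeries.coeff m (fundamentalSum F) =
      ∑ᶠ w : Word, F w * MvPowerSeries.coeff m (fundamentalOfWord w) := rfl

theorem coeff_fundamentalSum_indicator (S : Set Word) (m : ℕ+ →₀ ℕ) :
    MvPowerSeries.coeff m (fundamentalSum (indicator S)) = ((pairsOver S m).ncard : ℝ) := by
  classical
  -- For an infinite set `ncard` and `finsum` both default to zero, so no finiteness is needed.
  rw [coeff_fundamentalSum, ← (bottomRow_injOn_pairsOver S m).ncard_image, ← finsum_one]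
  refine Eq.trans ?_
    ((Nat.castAddMonoidHom ℝ).map_finsum_of_injective Nat.cast_injective _).symm
  refine finsum_congr fun w => ?_
  rw [finsum_eq_if, coeff_fundamentalOfWord, Nat.coe_castAddMonoidHom, Nat.cast_ite,
    Nat.cast_one, Nat.cast_zero]
  by_cases hw : w ∈ S
  · rw [indicator_of_mem hw, one_mul]
    refine if_congr ⟨?_, ?_⟩ rfl rfl
    · rintro ⟨P, hP, rfl⟩
      exact ⟨P, ⟨hP, hw⟩, rfl⟩
    · rintro ⟨P, hP, rfl⟩
      exact ⟨P, hP.1, rfl⟩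
  · rw [indicator_of_notMem hw, zero_mul, if_neg]
    rintro ⟨P, hP, rfl⟩
    exact hw hP.2

/-- The two sums agree term by term, hence also where `finsum` takes its default value. -/
theorem isQuasisymmetric_fundamentalSum (F : WordSeries) :
    IsQuasisymmetric (fundamentalSum F) := by
  intro k i j a
  rw [coeff_fundamentalSum, coeff_fundamentalSum]
  exact finsum_congr fun w => congrArg _ (isQuasisymmetric_fundamental _ _ k i j a)

/-- The multisets are grouped by the contents of their low and high parts, which add up to `m`.
Within a group, cutting at the largest letter of `h` is a bijection onto pairs of multisets over the
two classes. -/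
theorem pairsOver_productSet_ncard (h h' : Word) (m : ℕ+ →₀ ℕ)
    (hfin : (pairsOver (productSet h h') m).Finite) :
    (pairsOver (productSet h h') m).ncard = ∑ p ∈ Finset.HasAntidiagonal.antidiagonal m,
      (pairsOver {w | WeakKKnuth h w} p.1).ncard * (pairsOver {w | WeakKKnuth h' w} p.2).ncard := by
  classical
  set n := maxLetter h with hn
  set f : Multiset (ℕ+ ×ₗ ℕ+) → (ℕ+ →₀ ℕ) × (ℕ+ →₀ ℕ) := fun P =>
    (Multiset.toFinsupp (topRow (lowPairs n P)), Multiset.toFinsupp (topRow (highPairs n P)))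
  have top : ∀ P, topRow (lowPairs n P) + topRow (highPairs n P) = topRow P := fun P => by
    conv_rhs => rw [← lowPairs_add_highPairs n P, topRow_add, topRow_map_shiftPair]
  rw [Set.ncard_eq_toFinset_card _ hfin,
    Finset.card_eq_sum_card_fiberwise (f := f) (t := Finset.HasAntidiagonal.antidiagonal m)]
  · refine Finset.sum_congr rfl fun p hp => ?_
    rw [Finset.HasAntidiagonal.mem_antidiagonal] at hp
    -- Lower entries from the class of `h` are at most `n`, so the shifted union can be cut apart
    -- again.
    have hlow : ∀ {P}, P ∈ pairsOver {w | WeakKKnuth h w} p.1 →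
        ∀ x ∈ P, ((ofLex x).2 : ℕ) ≤ n := by
      intro P hP x hx
      have := (maxLetter_le_iff _ n).1 (hP.2.maxLetter_eq ▸ le_rfl : maxLetter (bottomRow P) ≤ n)
      exact this _ (mem_bottomRow.2 ⟨x, hx, rfl⟩)
    rw [← Set.ncard_prod, ← Set.ncard_coe_finset]
    symm
    refine Set.ncard_congr (fun q _ => q.1 + q.2.map (shiftPair n)) ?_ ?_ ?_
    · rintro ⟨P, Q⟩ ⟨hP, hQ⟩
      have e1 := lowPairs_add_map_shiftPair (hlow hP) Q
      have e2 := highPairs_add_map_shiftPair (hlow hP) Q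
      simp only [Finset.coe_filter, Set.Finite.mem_toFinset, Set.mem_ofPred_eq]
      refine ⟨⟨?_, ?_, ?_⟩, ?_⟩
      · rw [topRow_add, topRow_map_shiftPair, ← hp, map_add, hP.1, hQ.1]
      · rw [lowPart, ← bottomRow_filterMap (isRelabelling_lowLetter _)]
        exact (congrArg (fun R => WeakKKnuth h (bottomRow R)) e1).mpr hP.2
      · rw [highPart, ← bottomRow_filterMap (isRelabelling_highLetter _)]
        exact (congrArg (fun R => WeakKKnuth h' (bottomRow R)) e2).mpr hQ.2
      · simp only [f, e1, e2, hP.1, hQ.1, Finsupp.toMultiset_toFinsupp]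
    · rintro ⟨P, Q⟩ ⟨P', Q'⟩ ⟨hP, -⟩ ⟨hP', -⟩ he
      refine Prod.ext ?_ ?_
      · have := congrArg (lowPairs n) he
        simpa only [lowPairs_add_map_shiftPair (hlow hP), lowPairs_add_map_shiftPair (hlow hP')]
          using this
      · have := congrArg (highPairs n) he
        simpa only [highPairs_add_map_shiftPair (hlow hP), highPairs_add_map_shiftPair (hlow hP')]
          using this
    · intro P hP
      simp only [Finset.coe_filter, Set.Finite.mem_toFinset, Set.mem_ofPred_eq] at hP
      obtain ⟨⟨-, h1, h2⟩, rfl⟩ := hP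
      rw [lowPart, ← bottomRow_filterMap (isRelabelling_lowLetter _)] at h1
      rw [highPart, ← bottomRow_filterMap (isRelabelling_highLetter _)] at h2
      refine ⟨(lowPairs n P, highPairs n P), ⟨⟨?_, h1⟩, ⟨?_, h2⟩⟩, lowPairs_add_highPairs n P⟩
      · exact (Multiset.toFinsupp_toMultiset _).symm
      · exact (Multiset.toFinsupp_toMultiset _).symm
  · intro P hP
    have hP := hfin.mem_toFinset.1 hP
    rw [Finset.mem_coe, Finset.HasAntidiagonal.mem_antidiagonal]
    simp only [f]
    rw [← map_add, top, hP.1, Finsupp.toMultiset_toFinsupp]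

theorem fundamentalSum_wordClass_mul {h h' : Word} (hh : IsInitial h) (hh' : IsInitial h') :
    fundamentalSum (wordClass h * wordClass h') =
      fundamentalSum (wordClass h) * fundamentalSum (wordClass h') := by
  classical
  obtain ⟨k, hk⟩ := hh
  obtain ⟨k', hk'⟩ := hh'
  ext m
  have hfin := pairsOver_finite (S := productSet h h') (N := k + k') (fun u hu =>
    (maxLetter_of_initial (mem_iff_of_mem_productSet hk hk' hu)).le) m
  rw [wordClass_mul_wordClass, MvPowerSeries.coeff_mul, coeff_fundamentalSum_indicator,
    pairsOver_productSet_ncard h h' m hfin]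
  push_cast
  simp only [wordClass_eq_indicator, coeff_fundamentalSum_indicator]

/-! ### Linearity and multiplicativity on `SKPR` -/

/-- Words of one class share their letters, and elements of `SKPR` are finite combinations of
classes. The bound makes the sums defining `fundamentalSum` finite. -/
theorem exists_maxLetter_le_of_mem_SKPR {F : WordSeries} (hF : F ∈ SKPR) :
    ∃ N, ∀ w, F w ≠ 0 → maxLetter w ≤ N := by
  induction hF using Submodule.span_induction with
  | mem F hF =>
    obtain ⟨h, -, rfl⟩ := hF
    refine ⟨maxLetter h, fun w hw => ?_⟩
    by_contra hn
    exact hw (if_neg fun h' => hn h'.maxLetter_eq.ge)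
  | zero => exact ⟨0, fun w hw => absurd rfl hw⟩
  | add F G _ _ h1 h2 =>
    obtain ⟨N, hN⟩ := h1
    obtain ⟨M, hM⟩ := h2
    refine ⟨max N M, fun w hw => ?_⟩
    by_cases h : F w = 0
    · refine le_max_of_le_right (hM w fun h' => hw ?_)
      change F w + G w = 0
      rw [h, h', add_zero]
    · exact le_max_of_le_left (hN w h)
  | smul r F _ h1 =>
    obtain ⟨N, hN⟩ := h1
    refine ⟨N, fun w hw => hN w fun h => hw ?_⟩
    change r * F w = 0
    rw [h, mul_zero]

theorem finite_support_of_mem_SKPR {F : WordSeries} (hF : F ∈ SKPR) (m : ℕ+ →₀ ℕ) :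
    (Function.support fun w => F w * MvPowerSeries.coeff m (fundamentalOfWord w)).Finite := by
  obtain ⟨N, hN⟩ := exists_maxLetter_le_of_mem_SKPR hF
  refine (boundedWords_finite (Finsupp.toMultiset m).card N).subset fun w hw => ?_
  exact ⟨(length_eq_of_coeff_ne_zero (right_ne_zero_of_mul hw)).le, hN w (left_ne_zero_of_mul hw)⟩

theorem fundamentalSum_zero : fundamentalSum 0 = 0 := by
  ext m
  rw [coeff_fundamentalSum, map_zero]
  refine (finsum_congr fun w => ?_).trans finsum_zero
  exact zero_mul _

/-- Membership in `SKPR` supplies the finite supports without which `finsum` need not be additive.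
-/
theorem fundamentalSum_add {F G : WordSeries} (hF : F ∈ SKPR) (hG : G ∈ SKPR) :
    fundamentalSum (F + G) = fundamentalSum F + fundamentalSum G := by
  ext m
  rw [map_add, coeff_fundamentalSum, coeff_fundamentalSum, coeff_fundamentalSum,
    ← finsum_add_distrib (finite_support_of_mem_SKPR hF m) (finite_support_of_mem_SKPR hG m)]
  exact finsum_congr fun w => add_mul _ _ _

theorem fundamentalSum_smul (r : ℝ) (F : WordSeries) :
    fundamentalSum (r • F) = r • fundamentalSum F := by
  ext m
  rw [map_smul, coeff_fundamentalSum, coeff_fundamentalSum, smul_finsum]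
  exact finsum_congr fun w => mul_assoc _ _ _

/-- Bilinearity reduces this to two classes; closure of `SKPR` under products lets additivity apply
to the products. -/
theorem fundamentalSum_mul {F G : WordSeries} (hF : F ∈ SKPR) (hG : G ∈ SKPR) :
    fundamentalSum (F * G) = fundamentalSum F * fundamentalSum G := by
  refine Submodule.span_induction₂
    (p := fun F G _ _ => fundamentalSum (F * G) = fundamentalSum F * fundamentalSum G)
    ?_ ?_ ?_ ?_ ?_ ?_ ?_ hF hG
  · rintro _ _ ⟨h, hh, rfl⟩ ⟨h', hh', rfl⟩
    exact fundamentalSum_wordClass_mul hh hh'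
  · intro G _
    rw [zero_mul, fundamentalSum_zero, zero_mul]
  · intro F _
    rw [mul_zero, fundamentalSum_zero, mul_zero]
  · intro F F' G h h' h'' h1 h2
    rw [add_mul, fundamentalSum_add (mul_mem_SKPR h h'') (mul_mem_SKPR h' h''), h1, h2,
      fundamentalSum_add h h', add_mul]
  · intro F G G' h h' h'' h1 h2
    rw [mul_add, fundamentalSum_add (mul_mem_SKPR h h') (mul_mem_SKPR h h''), h1, h2,
      fundamentalSum_add h' h'', mul_add]
  · intro r F G _ _ h
    rw [smul_mul_assoc, fundamentalSum_smul, h, fundamentalSum_smul, smul_mul_assoc]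
  · intro r F G _ _ h
    rw [mul_smul_comm, fundamentalSum_smul, h, fundamentalSum_smul, mul_smul_comm]

theorem hasFormalSum_wordClass {h : Word} (hh : IsInitial h) :
    HasFormalSum (fun w : {w : Word // WeakKKnuth h w} => fundamentalOfWord w)
      (fundamentalSum (wordClass h)) := by
  intro m
  have hF : wordClass h ∈ SKPR := Submodule.subset_span ⟨h, hh, rfl⟩
  constructor
  · refine Set.Finite.of_finite_image ((finite_support_of_mem_SKPR hF m).subset ?_)
      Subtype.val_injective.injOn
    rintro _ ⟨w, hw, rfl⟩
    have : wordClass h w = 1 := if_pos w.2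
    simpa [this] using hw
  · rw [coeff_fundamentalSum, finsum_subtype_eq_finsum_cond (WeakKKnuth h)
      (f := fun w => MvPowerSeries.coeff m (fundamentalOfWord w))]
    refine finsum_congr fun w => ?_
    by_cases hw : WeakKKnuth h w
    · have : wordClass h w = 1 := if_pos hw
      simp [this, hw]
    · have : wordClass h w = 0 := if_neg hw
      simp [this, hw]

/-! ### The homomorphism and its uniqueness -/

theorem HasFormalSum.unique {ι : Type*} {f : ι → MvPowerSeries ℕ+ ℝ} {F G : MvPowerSeries ℕ+ ℝ}
    (hF : HasFormalSum f F) (hG : HasFormalSum f G) : F = G :=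
  MvPowerSeries.ext fun m => (hF m).2.trans (hG m).2.symm

/-- `SKPR` as an algebra of formal sums of words. -/
noncomputable def SKPRAlgebra : NonUnitalSubalgebra ℝ WordSeries where
  carrier := SKPR
  add_mem' := SKPR.add_mem
  zero_mem' := SKPR.zero_mem
  smul_mem' r _ := SKPR.smul_mem r
  mul_mem' := mul_mem_SKPR

/-- The algebra homomorphism from `SKPR` to quasisymmetric functions. -/
noncomputable def toQSym : SKPRAlgebra →ₙₐ[ℝ] QSym where
  toFun x := ⟨fundamentalSum x, isQuasisymmetric_fundamentalSum x⟩
  map_smul' r x := Subtype.ext (fundamentalSum_smul r x)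
  map_zero' := Subtype.ext fundamentalSum_zero
  map_add' x y := Subtype.ext (fundamentalSum_add x.2 y.2)
  map_mul' x y := Subtype.ext (fundamentalSum_mul x.2 y.2)

theorem mainTheorem10 :
    ∃ A : NonUnitalSubalgebra ℝ WordSeries, A.toSubmodule = SKPR ∧
      ∃ φ : A →ₙₐ[ℝ] QSym,
        (∀ (h : Word) (x : A), Word.IsInitial h → (x : WordSeries) = WordSeries.wordClass h →
          HasFormalSum (fun w : {w : Word // Word.WeakKKnuth h w} => fundamentalOfWord w)
            (φ x : MvPowerSeries ℕ+ ℝ)) ∧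
        ∀ ψ : A →ₗ[ℝ] QSym,
          (∀ (h : Word) (x : A), Word.IsInitial h → (x : WordSeries) = WordSeries.wordClass h →
            HasFormalSum (fun w : {w : Word // Word.WeakKKnuth h w} => fundamentalOfWord w)
              (ψ x : MvPowerSeries ℕ+ ℝ)) →
          ∀ x : A, ψ x = φ x := by
  have hφ : ∀ (h : Word) (x : SKPRAlgebra), Word.IsInitial h →
      (x : WordSeries) = WordSeries.wordClass h →
      HasFormalSum (fun w : {w : Word // Word.WeakKKnuth h w} => fundamentalOfWord w)
        (toQSym x : MvPowerSeries ℕ+ ℝ) := by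
    intro h x hh hx
    change HasFormalSum _ (fundamentalSum x)
    rw [hx]
    exact hasFormalSum_wordClass hh
  refine ⟨SKPRAlgebra, rfl, toQSym, hφ, ?_⟩
  rintro ψ hψ ⟨x, hx⟩
  -- A formal sum is unique, so `ψ` agrees with `toQSym` on the classes, which span.
  refine Submodule.span_induction
    (p := fun x hx => ψ (⟨x, hx⟩ : SKPRAlgebra) = toQSym ⟨x, hx⟩) ?_ ?_ ?_ ?_ hx
  · rintro _ ⟨h, hh, rfl⟩
    exact Subtype.ext ((hψ h _ hh rfl).unique (hφ h _ hh rfl))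
  · exact (map_zero ψ).trans (map_zero toQSym).symm
  · intro x y hx hy h1 h2
    refine (map_add ψ (⟨x, hx⟩ : SKPRAlgebra) ⟨y, hy⟩).trans ?_
    rw [h1, h2]
    exact (map_add toQSym (⟨x, hx⟩ : SKPRAlgebra) ⟨y, hy⟩).symm
  · intro r x hx h
    refine (map_smul ψ r (⟨x, hx⟩ : SKPRAlgebra)).trans ?_
    rw [h]
    exact (map_smul toQSym r (⟨x, hx⟩ : SKPRAlgebra)).symm
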